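/- Let $p,q\ge 2$ be integers. Let $\mathcal M_{p\times q}\subset\mathbb R^{p\times q}$ be the Monge polytope, i.e. the set of real $p\times q$ matrices $C=(c_{ij})$ with $c_{ij}\ge 0$ for all $i,j$, $\sum_{i,j}c_{ij}=1$, and $c_{ij}+c_{IJ}\le c_{iJ}+c_{Ij}$ whenever $i<I$ and $j<J$. For $1\le a<p$ and $1\le b<q$ let $\mathrm{NE}_{a\times b}$ (resp. $\mathrm{SW}_{a\times b}$) be the $p\times q$ matrix all of whose entries in the $a\times b$ block in the top right (resp. bottom left) corner equal $\frac1{ab}$, the other entries being $0$. For $1\le i\le p$ let $\mathrm{H}_i$ be the $p\times q$ matrix whose $i$-th row has all entries $\frac1q$, the other rows being $0$; for $1\le j\le q$ let $\mathrm{V}_j$ be the $p\times q$ matrix whose $j$-th column has all entries $\frac1p$, the other columns being $0$. In what follows, the ranges of $a,b$ (and $a',b'$), $i$, $j$ are always these. The edges (one-dimensional faces) of $\mathcal M_{p\times q}$ are exactly the convex hulls of the following pairs: 1. all pairs $\{\mathrm H_i,\mathrm{NE}_{a\times b}\}$, except those with $i=p$ and $a=p-1$; 2. all pairs $\{\mathrm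 H_i,\mathrm{SW}_{a\times b}\}$, except those with $i=1$ and $a=p-1$; 3. all pairs $\{\mathrm V_j,\mathrm{NE}_{a\times b}\}$, except those with $j=1$ and $b=q-1$; 4. all pairs $\{\mathrm V_j,\mathrm{SW}_{a\times b}\}$, except those with $j=q$ and $b=q-1$; 5. all pairs of distinct elements of $\{\mathrm{NE}_{a\times b}: 1\le a<p,\ 1\le b<q\}$; 6. all pairs of distinct elements of $\{\mathrm{SW}_{a\times b}: 1\le a<p,\ 1\le b<q\}$; 7. those pairs $\{\mathrm{NE}_{a\times b},\mathrm{SW}_{a'\times b'}\}$ such that $a+a'<p$, or $b+b'<q$, or ($a+a'=p$ and $b+b'=q$); 8. all pairs of distinct elements of $\{\mathrm H_i:1\le i\le p\}\cup\{\mathrm V_j:1\le j\le q\}$, except $\{\mathrm H_1,\mathrm H_2\}$ if $p=2$ and $\{\mathrm V_1,\mathrm V_2\}$ if $q=2$. For $p,q>2$, the number of edges of $\mathcal M_{p\times q}$ is $$\frac14\Big[24-18(p+q)+19pq+2(p^2+q^2)-7(p^2q+pq^2-p^2q^2)\Big].$$ For all $p,q\ge2$, the number of edges is this expression minus one for each of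 the parameters $p$, $q$ that equals $2$. -/

import Mathlib

namespace Monge

/-- The Monge property of a real `p × q` matrix. -/
def IsMonge {p q : ℕ} (C : Matrix (Fin p) (Fin q) ℝ) : Prop :=
  ∀ (i I : Fin p) (j J : Fin q), i < I → j < J → C i j + C I J ≤ C i J + C I j

/-- The probability simplex of `p × q` matrices: nonnegative entries with total sum `1`. -/
def probSimplex (p q : ℕ) : Set (Matrix (Fin p) (Fin q) ℝ) :=
  {A | (∀ i j, 0 ≤ A i j) ∧ ∑ i, ∑ j, A i j = 1}

/-- The Monge polytope. -/
def polytope (p q : ℕ) : Set (Matrix (Fin p) (Fin q) ℝ) :=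
  probSimplex p q ∩ {C | IsMonge C}

/-- `F` is a face of the convex set `P`: a convex subset of `P` such that whenever a point in the
open segment between two points of `P` lies in `F`, both of these points lie in `F`. -/
def IsFace {E : Type*} [AddCommGroup E] [Module ℝ E] (P F : Set E) : Prop :=
  Convex ℝ F ∧ IsExtreme ℝ P F

/-- An edge is a face whose affine span has dimension one. -/
def IsEdge {E : Type*} [AddCommGroup E] [Module ℝ E] (P F : Set E) : Prop :=
  IsFace P F ∧ Module.finrank ℝ (affineSpan ℝ F).direction = 1

/-- The set of all edges of the Monge polytope. -/
def edges (p q : ℕ) : Set (Set (Matrix (Fin p) (Fin q) ℝ)) :=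
  {F | IsEdge (polytope p q) F}

/-- The `p × q` matrix with an `a × b` block of ones in its northeast (top right) corner and zeros
elsewhere.  (`r : Fin p`, `c : Fin q` are the zero-based row and column numbers.) -/
def NE (p q a b : ℕ) : Matrix (Fin p) (Fin q) ℝ :=
  Matrix.of fun r c => if (r : ℕ) < a ∧ q ≤ (c : ℕ) + b then 1 else 0

/-- The `p × q` matrix with an `a × b` block of ones in its southwest (bottom left) corner and
zeros elsewhere. -/
def SW (p q a b : ℕ) : Matrix (Fin p) (Fin q) ℝ :=
  Matrix.of fun r c => if p ≤ (r : ℕ) + a ∧ (c : ℕ) < b then 1 else 0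

/-- The `p × q` matrix with ones in the `i`-th row (`1 ≤ i ≤ p`, rows numbered from one) and zeros
elsewhere. -/
def HOR (p q i : ℕ) : Matrix (Fin p) (Fin q) ℝ :=
  Matrix.of fun r _ => if (r : ℕ) + 1 = i then 1 else 0

/-- The `p × q` matrix with ones in the `j`-th column (`1 ≤ j ≤ q`, columns numbered from one) and
zeros elsewhere. -/
def VER (p q j : ℕ) : Matrix (Fin p) (Fin q) ℝ :=
  Matrix.of fun _ c => if (c : ℕ) + 1 = j then 1 else 0

/-- `NE` scaled to have entry sum one. -/
noncomputable def hatNE (p q a b : ℕ) : Matrix (Fin p) (Fin q) ℝ :=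
  (1 / ((a : ℝ) * (b : ℝ))) • NE p q a b

/-- `SW` scaled to have entry sum one. -/
noncomputable def hatSW (p q a b : ℕ) : Matrix (Fin p) (Fin q) ℝ :=
  (1 / ((a : ℝ) * (b : ℝ))) • SW p q a b

/-- `HOR` scaled to have entry sum one. -/
noncomputable def hatHOR (p q i : ℕ) : Matrix (Fin p) (Fin q) ℝ :=
  (1 / (q : ℝ)) • HOR p q i

/-- `VER` scaled to have entry sum one. -/
noncomputable def hatVER (p q j : ℕ) : Matrix (Fin p) (Fin q) ℝ :=
  (1 / (p : ℝ)) • VER p q j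

/-- `a × b` is an admissible block size in a `p × q` matrix: `1 ≤ a < p` and `1 ≤ b < q`. -/
def IsBlock (p q a b : ℕ) : Prop :=
  (1 ≤ a ∧ a < p) ∧ (1 ≤ b ∧ b < q)

/-- The northeast block vertices. -/
def verticesNE (p q : ℕ) : Set (Matrix (Fin p) (Fin q) ℝ) :=
  {v | ∃ a b, IsBlock p q a b ∧ v = hatNE p q a b}

/-- The southwest block vertices. -/
def verticesSW (p q : ℕ) : Set (Matrix (Fin p) (Fin q) ℝ) :=
  {v | ∃ a b, IsBlock p q a b ∧ v = hatSW p q a b}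

/-- The strip vertices, horizontal and vertical. -/
def verticesStrip (p q : ℕ) : Set (Matrix (Fin p) (Fin q) ℝ) :=
  {v | ∃ i, (1 ≤ i ∧ i ≤ p) ∧ v = hatHOR p q i} ∪ {v | ∃ j, (1 ≤ j ∧ j ≤ q) ∧ v = hatVER p q j}

end Monge

/-!
The cone of nonnegative Monge matrices is cut out by the entries and by the slacks of the Monge
inequalities, and the blocks, rows and columns represent its extremal rays.  To see that they
generate the cone, let `C` be a nonzero matrix in it.  If a row or a column of `C` has no zero, a
small multiple of it can be subtracted.  Otherwise, by the Monge inequalities, the positive entries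
form two staircases, one in the northeast and one in the southwest corner, and at an inner corner of
a staircase the Monge inequality of the four neighbouring entries is strict, so that a block can be
subtracted (`exists_corner`, `exists_tight_vert`).  The largest possible multiple makes a further
inequality tight, and an induction on the number of strict inequalities finishes the decomposition
(`ConeSlice.IsRaySystem.exists_comb`).

For any polytope described both by inequalities and by its vertices, two vertices span an edge if
and only if no third vertex satisfies with equality all inequalities that both of them do
(`ConeSlice.IsRaySystem.isEdge_iff`).  For the Monge polytope this says: the support of the third
vertex is not contained in the union of the two supports, or its inner corner (if it is a block) is
the inner corner of neither of the two (`dom_iff`).  The inner corner determines a northeast block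
and a southwest block, which are complementary, so few cases remain to be examined; the exceptional
pairs `Bad` are those whose supports together cover a row or a column that is neither of the two
(`isAdj_iff`).

The number of edges is half the number of ordered adjacent pairs in the graph of the polytope; the
nonadjacent ones are the diagonal and the pairs in `Bad`, in both orders (`sum_sum_adj`,
`sum_sum_bad`).
-/

/-! ### Edges of a polytope given by inequalities and candidate vertices -/

namespace ConeSlice

variable {E K α : Type*} [AddCommGroup E] [Module ℝ E]

/-- The slice `s = 1` of the cone cut out by the inequalities `0 ≤ ℓ k`. -/
def slice (ℓ : K → E →ₗ[ℝ] ℝ) (s : E →ₗ[ℝ] ℝ) : Set E :=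
  {C | (∀ k, 0 ≤ ℓ k C) ∧ s C = 1}

/-- `v z` satisfies with equality every inequality that both `v x` and `v y` satisfy with
equality; geometrically, `v z` lies in the smallest face containing `v x` and `v y`. -/
def Dom (ℓ : K → E →ₗ[ℝ] ℝ) (v : α → E) (z x y : α) : Prop :=
  ∀ k, ℓ k (v x) = 0 → ℓ k (v y) = 0 → ℓ k (v z) = 0

/-- The family `v` consists of representatives, normalized by `s = 1`, of the extremal rays of the
pointed cone `{C | ∀ k, 0 ≤ ℓ k C}`.  That the rays generate the cone is encoded by
`exists_tight`: every nonzero face of the cone contains one of them. -/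
structure IsRaySystem (ℓ : K → E →ₗ[ℝ] ℝ) (s : E →ₗ[ℝ] ℝ) (v : α → E) : Prop where
  nonneg : ∀ k x, 0 ≤ ℓ k (v x)
  sum_eq_one : ∀ x, s (v x) = 1
  pointed : ∀ C, (∀ k, ℓ k C = 0) → C = 0
  exists_tight : ∀ C, (∀ k, 0 ≤ ℓ k C) → C ≠ 0 → ∃ x, ∀ k, ℓ k C = 0 → ℓ k (v x) = 0
  extremal : ∀ x z, Dom ℓ v z x x → z = x

/-- The adjacency relation of rays: the smallest face containing `v x` and `v y` contains no
third ray. -/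
def IsAdj (ℓ : K → E →ₗ[ℝ] ℝ) (v : α → E) (x y : α) : Prop :=
  x ≠ y ∧ ∀ z, Dom ℓ v z x y → z = x ∨ z = y

/-- The ratio test: one can move from `f` in direction `-g` until an inequality becomes tight. -/
theorem exists_ratio [Fintype K] (f g : K → ℝ) (hf : ∀ k, 0 ≤ f k) (hg : ∀ k, 0 ≤ g k)
    (hfg : ∀ k, f k = 0 → g k = 0) (hne : ∃ k, g k ≠ 0) :
    ∃ ε : ℝ, 0 < ε ∧ (∀ k, 0 ≤ f k - ε * g k) ∧ ∃ k, f k ≠ 0 ∧ f k - ε * g k = 0 := by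
  classical
  obtain ⟨k₀, hk₀⟩ := hne
  obtain ⟨m, hm, hmin⟩ := Finset.exists_min_image (Finset.univ.filter fun k => g k ≠ 0)
    (fun k => f k / g k) ⟨k₀, by simpa using hk₀⟩
  have hgm : g m ≠ 0 := by simpa using hm
  have hgm' : 0 < g m := lt_of_le_of_ne (hg m) hgm.symm
  have hfm : 0 < f m := lt_of_le_of_ne (hf m) fun h => hgm (hfg m h.symm)
  refine ⟨f m / g m, div_pos hfm hgm', fun k => ?_, m, hfm.ne', ?_⟩
  · by_cases hk : g k = 0
    · simpa [hk] using hf k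
    · have hk' : 0 < g k := lt_of_le_of_ne (hg k) (Ne.symm hk)
      have := hmin k (by simpa using hk)
      rw [le_div_iff₀ hk'] at this
      linarith
  · field_simp
    ring

variable {ℓ : K → E →ₗ[ℝ] ℝ} {s : E →ₗ[ℝ] ℝ} {v : α → E}

namespace IsRaySystem

theorem mem_slice (h : IsRaySystem ℓ s v) (x : α) : v x ∈ slice ℓ s :=
  ⟨fun k => h.nonneg k x, h.sum_eq_one x⟩

theorem exists_ne_zero (h : IsRaySystem ℓ s v) (x : α) : ∃ k, ℓ k (v x) ≠ 0 := by
  by_contra! hx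
  have := h.sum_eq_one x
  rw [h.pointed _ hx] at this
  simp at this

theorem injective (h : IsRaySystem ℓ s v) : Function.Injective v := fun x z hxz =>
  h.extremal z x fun k hk _ => by rw [hxz, hk]

/-- A ray all of whose tight inequalities include those of `C` can be subtracted from `C` with a
positive coefficient, so that one more inequality becomes tight. -/
theorem exists_sub (h : IsRaySystem ℓ s v) [Fintype K] {C : E} (hC : ∀ k, 0 ≤ ℓ k C) {x : α}
    (hx : ∀ k, ℓ k C = 0 → ℓ k (v x) = 0) :
    ∃ ε : ℝ, 0 < ε ∧ (∀ k, 0 ≤ ℓ k (C - ε • v x)) ∧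
      ∃ k, ℓ k C ≠ 0 ∧ ℓ k (C - ε • v x) = 0 := by
  simpa using exists_ratio (fun k => ℓ k C) (fun k => ℓ k (v x)) hC (fun k => h.nonneg k x) hx
    (h.exists_ne_zero x)

/-- The rays generate the cone. -/
theorem exists_comb (h : IsRaySystem ℓ s v) [Fintype K] [Fintype α] (C : E)
    (hC : ∀ k, 0 ≤ ℓ k C) : ∃ c : α → ℝ, (∀ x, 0 ≤ c x) ∧ C = ∑ x, c x • v x := by
  classical
  induction hn : (Finset.univ.filter fun k => ℓ k C ≠ 0).card using Nat.strong_induction_on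
    generalizing C with
  | _ n ih =>
    by_cases hC0 : C = 0
    · exact ⟨0, by simp, by simp [hC0]⟩
    obtain ⟨x, hx⟩ := h.exists_tight C hC hC0
    obtain ⟨ε, hε, hD, m, hm, hm'⟩ := h.exists_sub hC hx
    have hlt : (Finset.univ.filter fun k => ℓ k (C - ε • v x) ≠ 0).card < n := by
      rw [← hn]
      refine Finset.card_lt_card (Finset.ssubset_iff_of_subset ?_ |>.2 ⟨m, ?_, ?_⟩)
      · intro k hk
        simp only [Finset.mem_filter, Finset.mem_univ, true_and] at hk ⊢
        intro h0
        apply hk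
        simp [h0, hx k h0]
      · simpa using hm
      · simpa using hm'
    obtain ⟨c, hc, hcC⟩ := ih _ hlt _ hD rfl
    refine ⟨c + Pi.single x ε, fun y => add_nonneg (hc y) ?_, ?_⟩
    · by_cases hy : y = x
      · subst hy; simpa using hε.le
      · simp [hy]
    · simp only [Pi.add_apply, add_smul, Finset.sum_add_distrib, ← hcC]
      rw [Finset.sum_eq_single x]
      · simp
      · intro y _ hy
        simp [hy]
      · simp

theorem sum_nonneg (h : IsRaySystem ℓ s v) [Fintype K] [Fintype α] {C : E}
    (hC : ∀ k, 0 ≤ ℓ k C) : 0 ≤ s C := by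
  obtain ⟨c, hc, rfl⟩ := h.exists_comb C hC
  simpa [h.sum_eq_one] using Finset.sum_nonneg fun x _ => hc x

theorem eq_zero_of_sum (h : IsRaySystem ℓ s v) [Fintype K] [Fintype α] {C : E}
    (hC : ∀ k, 0 ≤ ℓ k C) (h0 : s C = 0) : C = 0 := by
  obtain ⟨c, hc, rfl⟩ := h.exists_comb C hC
  simp only [map_sum, map_smul, h.sum_eq_one, smul_eq_mul, mul_one] at h0
  rw [Finset.sum_eq_zero_iff_of_nonneg fun x _ => hc x] at h0
  exact Finset.sum_eq_zero fun x hx => by rw [h0 x hx, zero_smul]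

theorem convex_slice : Convex ℝ (slice ℓ s) := by
  rintro x ⟨hx, hx1⟩ y ⟨hy, hy1⟩ a b ha hb hab
  refine ⟨fun k => ?_, ?_⟩
  · have := mul_nonneg ha (hx k)
    have := mul_nonneg hb (hy k)
    simp only [map_add, map_smul, smul_eq_mul]
    linarith
  · simpa [hx1, hy1] using hab

/-- If a positive multiple of `u` can be split off from a point of the face `F`, then `u` lies
in `F`. -/
theorem mem_face (h : IsRaySystem ℓ s v) [Fintype K] [Fintype α] {F : Set E}
    (hF : IsExtreme ℝ (slice ℓ s) F) {C u : E} (hC : C ∈ F) (hu : u ∈ slice ℓ s) {ε : ℝ}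
    (hε : 0 < ε) (hD : ∀ k, 0 ≤ ℓ k (C - ε • u)) : u ∈ F := by
  have hs : s (C - ε • u) = 1 - ε := by simp [(hF.subset hC).2, hu.2]
  have hle : 0 ≤ 1 - ε := hs ▸ h.sum_nonneg hD
  rcases hle.eq_or_lt with h0 | hlt
  · have := h.eq_zero_of_sum hD (hs.trans h0.symm)
    have h1 : ε = 1 := by linarith
    rw [h1, one_smul, sub_eq_zero] at this
    exact this ▸ hC
  · refine hF.left_mem_of_mem_openSegment hu (y := (1 - ε)⁻¹ • (C - ε • u)) ⟨fun k => ?_, ?_⟩ hC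
      ⟨ε, 1 - ε, hε, hlt, by ring, ?_⟩
    · rw [map_smul]
      exact mul_nonneg (inv_nonneg.2 hle) (hD k)
    · rw [map_smul, hs, smul_eq_mul, inv_mul_cancel₀ hlt.ne']
    · rw [smul_inv_smul₀ hlt.ne', add_sub_cancel]

theorem dom_of_mem_segment {C : E} {x y : α} (hC : C ∈ segment ℝ (v x) (v y)) (k : K)
    (hx : ℓ k (v x) = 0) (hy : ℓ k (v y) = 0) : ℓ k C = 0 := by
  obtain ⟨a, b, _, _, _, rfl⟩ := hC
  simp [hx, hy]

theorem mem_segment_of_tight (h : IsRaySystem ℓ s v) [Fintype K] [Fintype α] {x y : α}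
    (hxy : IsAdj ℓ v x y) {C : E} (hC : C ∈ slice ℓ s)
    (ht : ∀ k, ℓ k (v x) = 0 → ℓ k (v y) = 0 → ℓ k C = 0) : C ∈ segment ℝ (v x) (v y) := by
  classical
  obtain ⟨c, hc, hcC⟩ := h.exists_comb C hC.1
  have hz : ∀ z, z ≠ x → z ≠ y → c z = 0 := by
    intro z hzx hzy
    by_contra hcz
    have hdom : Dom ℓ v z x y := by
      intro k hkx hky
      have h0 := ht k hkx hky
      rw [hcC] at h0
      simp only [map_sum, map_smul, smul_eq_mul] at h0
      rw [Finset.sum_eq_zero_iff_of_nonneg fun w _ => mul_nonneg (hc w) (h.nonneg k w)] at h0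
      exact (mul_eq_zero.1 (h0 z (Finset.mem_univ z))).resolve_left hcz
    rcases hxy.2 z hdom with h1 | h1
    · exact hzx h1
    · exact hzy h1
  have hsum : C = c x • v x + c y • v y := by
    rw [hcC, ← Finset.sum_pair (f := fun z => c z • v z) hxy.1]
    symm
    apply Finset.sum_subset (Finset.subset_univ _)
    intro z _ hz'
    simp only [Finset.mem_insert, Finset.mem_singleton, not_or] at hz'
    rw [hz z hz'.1 hz'.2, zero_smul]
  refine ⟨c x, c y, hc x, hc y, ?_, hsum.symm⟩
  have := hC.2
  rw [hsum] at this
  simpa [h.sum_eq_one] using this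

theorem mem_segment_iff_of_isAdj {x y z : α} (hxy : IsAdj ℓ v x y) :
    v z ∈ segment ℝ (v x) (v y) ↔ z = x ∨ z = y := by
  constructor
  · intro hz
    exact hxy.2 z fun k => dom_of_mem_segment hz k
  · rintro (rfl | rfl)
    · exact left_mem_segment _ _ _
    · exact right_mem_segment _ _ _

theorem isEdge_of_isAdj (h : IsRaySystem ℓ s v) [Fintype K] [Fintype α] {x y : α}
    (hxy : IsAdj ℓ v x y) : Monge.IsEdge (slice ℓ s) (convexHull ℝ {v x, v y}) := by
  refine ⟨⟨convex_convexHull _ _, ?_, ?_⟩, ?_⟩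
  · rw [convexHull_pair]
    exact convex_slice.segment_subset (h.mem_slice x) (h.mem_slice y)
  · rw [convexHull_pair]
    rintro A hA B hB z hz ⟨a, b, ha, hb, hab, rfl⟩
    refine h.mem_segment_of_tight hxy hA fun k hkx hky => ?_
    have h0 := dom_of_mem_segment hz k hkx hky
    simp only [map_add, map_smul, smul_eq_mul] at h0
    have hA' := mul_nonneg ha.le (hA.1 k)
    have hB' := mul_nonneg hb.le (hB.1 k)
    exact (mul_eq_zero.1 (by linarith : a * ℓ k A = 0)).resolve_left ha.ne'
  · rw [affineSpan_convexHull, direction_affineSpan, vectorSpan_pair]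
    apply finrank_span_singleton
    rw [vsub_eq_sub, sub_ne_zero]
    exact h.injective.ne hxy.1

/-- A face of dimension one is the segment between the first and the last of the rays it contains,
in the order along the line it spans. -/
theorem exists_eq_segment (h : IsRaySystem ℓ s v) [Fintype K] [Fintype α] {F : Set E}
    (hF : Monge.IsEdge (slice ℓ s) F) :
    ∃ x y, x ≠ y ∧ F = segment ℝ (v x) (v y) := by
  classical
  obtain ⟨⟨hconv, hext⟩, hdim⟩ := hF
  have hne : F.Nonempty := by
    by_contra hne
    rw [Set.not_nonempty_iff_eq_empty] at hne
    rw [hne, AffineSubspace.span_empty, AffineSubspace.direction_bot, finrank_bot] at hdim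
    exact zero_ne_one hdim
  obtain ⟨o, ho⟩ := hne
  have hcomb : ∀ C ∈ F, ∃ c : α → ℝ, (∀ x, 0 ≤ c x) ∧ ∑ x, c x = 1 ∧ C = ∑ x, c x • v x ∧
      ∀ x, c x ≠ 0 → v x ∈ F := by
    intro C hC
    have hCP := hext.subset hC
    obtain ⟨c, hc, hcC⟩ := h.exists_comb C hCP.1
    refine ⟨c, hc, ?_, hcC, fun x hx => ?_⟩
    · have := hCP.2
      rw [hcC] at this
      simpa [h.sum_eq_one] using this
    · refine h.mem_face hext hC (h.mem_slice x) (lt_of_le_of_ne (hc x) hx.symm) fun k => ?_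
      have : C - c x • v x = ∑ z ∈ Finset.univ.erase x, c z • v z := by
        rw [hcC, ← Finset.add_sum_erase _ _ (Finset.mem_univ x)]
        abel
      rw [this, map_sum]
      exact Finset.sum_nonneg fun z _ => by
        rw [map_smul]; exact mul_nonneg (hc z) (h.nonneg k z)
  obtain ⟨⟨d, hd⟩, hd0, hspan⟩ := finrank_eq_one_iff'.1 hdim
  have hline : ∀ A ∈ F, ∃ t : ℝ, A = o + t • d := by
    intro A hA
    obtain ⟨t, ht⟩ := hspan ⟨A -ᵥ o, AffineSubspace.vsub_mem_direction
      (subset_affineSpan ℝ F hA) (subset_affineSpan ℝ F ho)⟩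
    refine ⟨t, ?_⟩
    have := congrArg Subtype.val ht
    simp only [SetLike.mk_smul_mk, vsub_eq_sub] at this
    rw [this]
    abel
  choose! t ht using hline
  have hS : (Finset.univ.filter fun x => v x ∈ F).Nonempty := by
    obtain ⟨c, _, hc1, _, hcF⟩ := hcomb o ho
    by_contra hS
    rw [Finset.not_nonempty_iff_eq_empty, Finset.filter_eq_empty_iff] at hS
    rw [Finset.sum_eq_zero fun x hx => by_contra fun h0 => hS hx (hcF x h0)] at hc1
    exact zero_ne_one hc1
  obtain ⟨x, hx, hmin⟩ := Finset.exists_min_image _ (fun x => t (v x)) hS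
  obtain ⟨y, hy, hmax⟩ := Finset.exists_max_image _ (fun x => t (v x)) hS
  simp only [Finset.mem_filter, Finset.mem_univ, true_and] at hx hy hmin hmax
  have hsub : F ⊆ segment ℝ (v x) (v y) := by
    intro C hC
    obtain ⟨c, hc, hc1, hcC, hcF⟩ := hcomb C hC
    rw [hcC]
    have hz : ∀ z, c z ≠ 0 → v z ∈ segment ℝ (v x) (v y) := by
      intro z hcz
      have hzF := hcF z hcz
      have h1 := hmin z hzF
      have h2 := hmax z hzF
      have hseg : t (v z) ∈ segment ℝ (t (v x)) (t (v y)) := by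
        rw [segment_eq_Icc (h1.trans h2)]; exact ⟨h1, h2⟩
      obtain ⟨a, b, ha, hb, hab, hz⟩ := hseg
      refine ⟨a, b, ha, hb, hab, ?_⟩
      rw [ht _ hx, ht _ hy, ht _ hzF, ← hz]
      have ho' : o = (a + b) • o := by rw [hab, one_smul]
      conv_rhs => rw [ho']
      simp only [smul_eq_mul]
      module
    rw [← Finset.sum_filter_add_sum_filter_not Finset.univ (fun z => c z ≠ 0),
      Finset.sum_eq_zero (s := Finset.univ.filter fun z => ¬ c z ≠ 0), add_zero]
    · refine (convex_segment _ _).sum_mem (fun z _ => hc z) ?_ fun z hz' => hz z (by simpa using hz')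
      rw [Finset.sum_filter_ne_zero, hc1]
    · intro z hz'
      have : c z = 0 := by simpa using hz'
      rw [this, zero_smul]
  have hFeq := hsub.antisymm (hconv.segment_subset hx hy)
  refine ⟨x, y, ?_, hFeq⟩
  rintro rfl
  rw [hFeq, segment_same, direction_affineSpan, vectorSpan_singleton] at hdim
  simp at hdim

theorem exists_isAdj_of_isEdge (h : IsRaySystem ℓ s v) [Fintype K] [Fintype α] {F : Set E}
    (hF : Monge.IsEdge (slice ℓ s) F) :
    ∃ x y, IsAdj ℓ v x y ∧ F = convexHull ℝ {v x, v y} := by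
  obtain ⟨x, y, hxy, rfl⟩ := h.exists_eq_segment hF
  refine ⟨x, y, ⟨hxy, fun z hz => ?_⟩, (convexHull_pair _ _).symm⟩
  have hmid : (1 / 2 : ℝ) • v x + (1 / 2 : ℝ) • v y ∈ segment ℝ (v x) (v y) :=
    ⟨1 / 2, 1 / 2, by norm_num, by norm_num, by norm_num, rfl⟩
  obtain ⟨ε, hε, hD, _⟩ := h.exists_sub (hF.1.2.subset hmid).1 (x := z) fun k hk => by
    have h1 := h.nonneg k x
    have h2 := h.nonneg k y
    simp only [map_add, map_smul, smul_eq_mul] at hk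
    exact hz k (by linarith) (by linarith)
  obtain ⟨a, b, ha, hb, hab, hzab⟩ := h.mem_face hF.1.2 hmid (h.mem_slice z) hε hD
  -- `v z` is a convex combination of `v x` and `v y`, hence equal to an end by extremality.
  have key : ∀ k, ℓ k (v z) = 0 → a * ℓ k (v x) = 0 ∧ b * ℓ k (v y) = 0 := by
    intro k hk
    rw [← hzab] at hk
    simp only [map_add, map_smul, smul_eq_mul] at hk
    have h1 := mul_nonneg ha (h.nonneg k x)
    have h2 := mul_nonneg hb (h.nonneg k y)
    constructor <;> linarith
  by_cases ha0 : a = 0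
  · right
    have hb0 : b ≠ 0 := by rintro rfl; simp [ha0] at hab
    exact (h.extremal z y fun k hk _ => (mul_eq_zero.1 (key k hk).2).resolve_left hb0).symm
  · left
    exact (h.extremal z x fun k hk _ => (mul_eq_zero.1 (key k hk).1).resolve_left ha0).symm

theorem isEdge_iff (h : IsRaySystem ℓ s v) [Fintype K] [Fintype α] {F : Set E} :
    Monge.IsEdge (slice ℓ s) F ↔ ∃ x y, IsAdj ℓ v x y ∧ F = convexHull ℝ {v x, v y} := by
  refine ⟨h.exists_isAdj_of_isEdge, ?_⟩
  rintro ⟨x, y, hxy, rfl⟩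
  exact h.isEdge_of_isAdj hxy

/-- Different pairs of adjacent rays span different edges. -/
theorem sym2_eq_of_convexHull_eq {x y x' y' : α}
    (hxy : IsAdj ℓ v x y) (hxy' : IsAdj ℓ v x' y')
    (heq : convexHull ℝ {v x, v y} = convexHull ℝ {v x', v y'}) : s(x, y) = s(x', y') := by
  rw [convexHull_pair, convexHull_pair] at heq
  have hmem : ∀ z, (z = x ∨ z = y) ↔ (z = x' ∨ z = y') := fun z => by
    rw [← mem_segment_iff_of_isAdj hxy, ← mem_segment_iff_of_isAdj hxy', heq]
  have hne := hxy.1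
  rw [Sym2.eq_iff]
  rcases (hmem x).1 (Or.inl rfl) with h1 | h1 <;> rcases (hmem y).1 (Or.inr rfl) with h2 | h2
  · exact absurd (h1.trans h2.symm) hne
  · exact Or.inl ⟨h1, h2⟩
  · exact Or.inr ⟨h1, h2⟩
  · exact absurd (h1.trans h2.symm) hne

/-- The edges of the slice are in bijection with the edges of any graph whose adjacency is the
adjacency of rays. -/
theorem ncard_edges (h : IsRaySystem ℓ s v) [Fintype K] [Fintype α] (G : SimpleGraph α)
    [Fintype G.edgeSet] (hG : ∀ x y, G.Adj x y ↔ IsAdj ℓ v x y) :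
    {F | Monge.IsEdge (slice ℓ s) F}.ncard = G.edgeFinset.card := by
  have himg : {F | Monge.IsEdge (slice ℓ s) F} =
      (fun e : Sym2 α => convexHull ℝ (v '' {x | x ∈ e})) '' G.edgeSet := by
    ext F
    simp only [Set.mem_ofPred_eq, h.isEdge_iff, Set.mem_image]
    constructor
    · rintro ⟨x, y, hxy, rfl⟩
      refine ⟨s(x, y), (hG x y).2 hxy, ?_⟩
      congr 1
      ext; simp [eq_comm]
    · rintro ⟨e, he, rfl⟩
      induction e with
      | _ x y =>
        refine ⟨x, y, (hG x y).1 he, ?_⟩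
        congr 1
        ext; simp [eq_comm]
  rw [himg, Set.InjOn.ncard_image, Set.ncard_eq_toFinset_card', SimpleGraph.edgeFinset]
  intro e he e' he' heq
  induction e with
  | _ x y =>
    induction e' with
    | _ x' y' =>
      refine sym2_eq_of_convexHull_eq ((hG x y).1 he) ((hG x' y').1 he') ?_
      convert heq using 2 <;> (ext; simp [eq_comm])

end IsRaySystem

end ConeSlice

/-! ### The constraints and the candidate vertices of the Monge polytope -/

namespace Monge

/-- Index set of the vertices: northeast blocks, southwest blocks, rows, columns.  The index
`(a, b)` of a block stands for the size `(a + 1) × (b + 1)`; rows and columns are numbered from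
zero. -/
abbrev Index (p q : ℕ) : Type :=
  (Fin (p - 1) × Fin (q - 1)) ⊕ (Fin (p - 1) × Fin (q - 1)) ⊕ Fin p ⊕ Fin q

variable {p q : ℕ}

/-- The vertex with the given index. -/
noncomputable def vert : Index p q → Matrix (Fin p) (Fin q) ℝ
  | .inl (a, b) => hatNE p q (a + 1) (b + 1)
  | .inr (.inl (a, b)) => hatSW p q (a + 1) (b + 1)
  | .inr (.inr (.inl i)) => hatHOR p q (i + 1)
  | .inr (.inr (.inr j)) => hatVER p q (j + 1)

/-- The common value of the nonzero entries of a vertex. -/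
noncomputable def wt : Index p q → ℝ
  | .inl (a, b) => 1 / ((a + 1 : ℕ) * (b + 1 : ℕ))
  | .inr (.inl (a, b)) => 1 / ((a + 1 : ℕ) * (b + 1 : ℕ))
  | .inr (.inr (.inl _)) => 1 / q
  | .inr (.inr (.inr _)) => 1 / p

/-- `Supp x r c`: the entry `(r, c)` of the vertex `x` is nonzero. -/
def Supp : Index p q → ℕ → ℕ → Prop
  | .inl (a, b), r, c => r ≤ a ∧ q ≤ c + b + 1
  | .inr (.inl (a, b)), r, c => p ≤ r + a + 1 ∧ c ≤ b
  | .inr (.inr (.inl i)), r, _ => r = i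
  | .inr (.inr (.inr j)), _, c => c = j

/-- `Cut x i I j J`: the Monge inequality of the vertex `x` for the rows `i < I` and the columns
`j < J` is strict, that is, the inner corner of the block lies between these lines. -/
def Cut : Index p q → ℕ → ℕ → ℕ → ℕ → Prop
  | .inl (a, b), i, I, j, J => i ≤ a ∧ a < I ∧ j + b + 1 < q ∧ q ≤ J + b + 1
  | .inr (.inl (a, b)), i, I, j, J => i + a + 1 < p ∧ p ≤ I + a + 1 ∧ j ≤ b ∧ b < J
  | .inr (.inr _), _, _, _, _ => False

instance (x : Index p q) (r c : ℕ) : Decidable (Supp x r c) := by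
  rcases x with ⟨a, b⟩ | ⟨a, b⟩ | i | j <;> unfold Supp <;> infer_instance

instance (x : Index p q) (i I j J : ℕ) : Decidable (Cut x i I j J) := by
  rcases x with ⟨a, b⟩ | ⟨a, b⟩ | i | j <;> unfold Cut <;> infer_instance

/-- The amount by which `C` satisfies the Monge inequality for rows `i, I` and columns `j, J`. -/
def slack (i I : Fin p) (j J : Fin q) : Matrix (Fin p) (Fin q) ℝ →ₗ[ℝ] ℝ :=
  Matrix.entryLinearMap ℝ ℝ i J + Matrix.entryLinearMap ℝ ℝ I j -
    Matrix.entryLinearMap ℝ ℝ i j - Matrix.entryLinearMap ℝ ℝ I J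

@[simp]
theorem slack_apply (i I : Fin p) (j J : Fin q) (C : Matrix (Fin p) (Fin q) ℝ) :
    slack i I j J C = C i J + C I j - C i j - C I J := rfl

/-- The functionals whose nonnegativity defines the cone of nonnegative Monge matrices: the
entries and the Monge slacks.  The slack is replaced by `0` when the rows or the columns are not
in increasing order, so that the index type carries no proofs. -/
def con : (Fin p × Fin q) ⊕ ((Fin p × Fin p) × (Fin q × Fin q)) →
    Matrix (Fin p) (Fin q) ℝ →ₗ[ℝ] ℝ
  | .inl (i, j) => Matrix.entryLinearMap ℝ ℝ i j
  | .inr ((i, I), (j, J)) => if i < I ∧ j < J then slack i I j J else 0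

/-- The sum of all entries. -/
def total : Matrix (Fin p) (Fin q) ℝ →ₗ[ℝ] ℝ :=
  ∑ i, ∑ j, Matrix.entryLinearMap ℝ ℝ i j

theorem total_apply (C : Matrix (Fin p) (Fin q) ℝ) : total C = ∑ i, ∑ j, C i j := by
  simp [total]

theorem con_nonneg_iff (C : Matrix (Fin p) (Fin q) ℝ) :
    (∀ k, 0 ≤ con k C) ↔ (∀ i j, 0 ≤ C i j) ∧ IsMonge C := by
  constructor
  · intro h
    refine ⟨fun i j => h (.inl (i, j)), fun i I j J hi hj => ?_⟩
    have := h (.inr ((i, I), (j, J)))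
    simp only [con, hi, hj, and_self, if_true, slack_apply] at this
    linarith
  · rintro ⟨h0, hM⟩ (⟨i, j⟩ | ⟨⟨i, I⟩, ⟨j, J⟩⟩)
    · exact h0 i j
    · by_cases hij : i < I ∧ j < J
      · have := hM i I j J hij.1 hij.2
        simp only [con, hij, and_self, if_true, slack_apply]
        linarith
      · simp [con, hij]

theorem polytope_eq_slice : polytope p q = ConeSlice.slice con total := by
  ext C
  simp only [polytope, probSimplex, ConeSlice.slice, Set.mem_inter_iff, Set.mem_ofPred_eq,
    con_nonneg_iff, total_apply]
  tauto

theorem vert_apply (x : Index p q) (r : Fin p) (c : Fin q) :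
    vert x r c = if Supp x r c then wt x else 0 := by
  rcases x with ⟨a, b⟩ | ⟨a, b⟩ | i | j
  · simp only [vert, hatNE, NE, Supp, wt, Matrix.smul_apply, Matrix.of_apply, smul_eq_mul,
      mul_ite, mul_one, mul_zero]
    congr 1
    exact propext (by omega)
  · simp only [vert, hatSW, SW, Supp, wt, Matrix.smul_apply, Matrix.of_apply, smul_eq_mul,
      mul_ite, mul_one, mul_zero]
    congr 1
    exact propext (by omega)
  · simp [vert, hatHOR, HOR, Supp, wt]
  · simp [vert, hatVER, VER, Supp, wt]

theorem wt_pos (x : Index p q) : 0 < wt x ∨ p = 0 ∨ q = 0 := by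
  rcases Nat.eq_zero_or_pos p with hp | hp
  · exact Or.inr (Or.inl hp)
  rcases Nat.eq_zero_or_pos q with hq | hq
  · exact Or.inr (Or.inr hq)
  left
  rcases x with ⟨a, b⟩ | ⟨a, b⟩ | i | j <;> simp only [wt] <;> positivity

theorem wt_pos_of (x : Index p q) (r : Fin p) (c : Fin q) : 0 < wt x := by
  have := r.pos
  have := c.pos
  exact (wt_pos x).resolve_right (by omega)

theorem slack_vert (x : Index p q) {i I : Fin p} {j J : Fin q} (hi : i < I) (hj : j < J) :
    slack i I j J (vert x) = if Cut x i I j J then wt x else 0 := by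
  rw [Fin.lt_def] at hi hj
  simp only [slack_apply, vert_apply]
  rcases x with ⟨a, b⟩ | ⟨a, b⟩ | k | k <;> simp only [Supp, Cut] <;> grind

theorem con_vert_nonneg (k) (x : Index p q) : 0 ≤ con k (vert x) := by
  rcases k with ⟨i, j⟩ | ⟨⟨i, I⟩, ⟨j, J⟩⟩
  · change 0 ≤ vert x i j
    rw [vert_apply]
    split_ifs
    exacts [(wt_pos_of x i j).le, le_rfl]
  · by_cases hij : i < I ∧ j < J
    · simp only [con, hij, and_self, if_true]
      rw [slack_vert x hij.1 hij.2]
      split_ifs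
      exacts [(wt_pos_of x i j).le, le_rfl]
    · simp [con, hij]

theorem con_pointed (C : Matrix (Fin p) (Fin q) ℝ) (h : ∀ k, con k C = 0) : C = 0 := by
  ext i j
  exact h (.inl (i, j))

/-- Domination of vertices in terms of supports and inner corners. -/
theorem dom_iff (z x y : Index p q) :
    ConeSlice.Dom con vert z x y ↔
      (∀ (r : Fin p) (c : Fin q), Supp z r c → Supp x r c ∨ Supp y r c) ∧
      ∀ (i I : Fin p) (j J : Fin q), i < I → j < J → Cut z i I j J →
        Cut x i I j J ∨ Cut y i I j J := by
  constructor
  · intro h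
    refine ⟨fun r c hz => ?_, fun i I j J hi hj hz => ?_⟩
    · by_contra! hxy
      have := h (.inl (r, c))
      simp [con, vert_apply, hxy, hz, (wt_pos_of z r c).ne'] at this
    · by_contra! hxy
      have := h (.inr ((i, I), (j, J)))
      simp only [con, hi, hj, and_self, if_true, slack_vert _ hi hj, hxy, if_false, hz,
        (wt_pos_of z i j).ne', true_implies] at this
  · rintro ⟨hS, hC⟩ (⟨i, j⟩ | ⟨⟨i, I⟩, ⟨j, J⟩⟩)
    · change vert x i j = 0 → vert y i j = 0 → vert z i j = 0
      have hx := (wt_pos_of x i j).ne'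
      have hy := (wt_pos_of y i j).ne'
      have := hS i j
      simp only [vert_apply]
      grind
    · by_cases hij : i < I ∧ j < J
      · have hx := (wt_pos_of x i j).ne'
        have hy := (wt_pos_of y i j).ne'
        have := hC i I j J hij.1 hij.2
        simp only [con, hij, and_self, if_true, slack_vert _ hij.1 hij.2]
        grind
      · simp [con, hij]

theorem sum_ite_val_lt {n m : ℕ} (hm : m ≤ n) :
    ∑ r : Fin n, (if (r : ℕ) < m then (1 : ℝ) else 0) = m := by
  rw [Fin.sum_univ_eq_sum_range (fun r => if r < m then (1 : ℝ) else 0), Finset.sum_ite]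
  have : (Finset.range n).filter (· < m) = Finset.range m := by ext; simp; omega
  simp [this]

theorem sum_ite_le_val_add {n m : ℕ} (hm : m ≤ n) :
    ∑ r : Fin n, (if n ≤ (r : ℕ) + m then (1 : ℝ) else 0) = m := by
  rw [← sum_ite_val_lt hm, ← Equiv.sum_comp Fin.revPerm]
  refine Finset.sum_congr rfl fun r _ => ?_
  congr 1
  simp only [Fin.revPerm_apply, Fin.val_rev]
  exact propext (by omega)

theorem total_vert (hp : p ≠ 0) (hq : q ≠ 0) (x : Index p q) : total (vert x) = 1 := by
  rw [total_apply]
  simp only [vert_apply]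
  rcases x with ⟨a, b⟩ | ⟨a, b⟩ | i | j
  · have hpq : ∀ (r : Fin p) (c : Fin q), (if Supp (.inl (a, b) : Index p q) r c then
        wt (.inl (a, b) : Index p q) else 0) = wt (.inl (a, b) : Index p q) *
        ((if (r : ℕ) < a + 1 then 1 else 0) * if q ≤ (c : ℕ) + (b + 1) then 1 else 0) := by
      intro r c
      simp only [Supp]
      grind
    simp only [hpq, ← Finset.mul_sum, ← Finset.sum_mul]
    rw [sum_ite_val_lt (by omega), sum_ite_le_val_add (by omega), wt]
    field_simp
  · have hpq : ∀ (r : Fin p) (c : Fin q), (if Supp (.inr (.inl (a, b)) : Index p q) r c then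
        wt (.inr (.inl (a, b)) : Index p q) else 0) = wt (.inr (.inl (a, b)) : Index p q) *
        ((if p ≤ (r : ℕ) + (a + 1) then 1 else 0) * if (c : ℕ) < b + 1 then 1 else 0) := by
      intro r c
      simp only [Supp]
      grind
    simp only [hpq, ← Finset.mul_sum, ← Finset.sum_mul]
    rw [sum_ite_val_lt (by omega), sum_ite_le_val_add (by omega), wt]
    field_simp
  · simp [Supp, wt, Fin.val_inj, hq]
  · simp [Supp, wt, Fin.val_inj, hp]

end Monge

/-! ### Generation of the cone of nonnegative Monge matrices -/

namespace Monge

variable {p q : ℕ}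

/-- The slack of a Monge inequality is the sum of the slacks of neighbouring rows and columns, so
it is positive as soon as one of these is. -/
theorem IsMonge.slack_pos {C : Matrix (Fin p) (Fin q) ℝ} (hM : IsMonge C) {i r r' I : Fin p}
    {j s' s J : Fin q} (hi : i ≤ r) (hr : r < r') (hI : r' ≤ I) (hj : j ≤ s') (hs : s' < s)
    (hJ : s ≤ J) (hpos : C r s' + C r' s < C r s + C r' s') : 0 < slack i I j J C := by
  have hM' : ∀ (i I : Fin p) (j J : Fin q), i ≤ I → j ≤ J → C i j + C I J ≤ C i J + C I j := by
    intro i I j J hi hj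
    rcases hi.eq_or_lt with rfl | hi
    · linarith
    rcases hj.eq_or_lt with rfl | hj
    · linarith
    exact hM i I j J hi hj
  have h1 := hM' i r j J hi ((hj.trans hs.le).trans hJ)
  have h2 := hM' r' I j J hI ((hj.trans hs.le).trans hJ)
  have h3 := hM' r r' j s' hr.le hj
  have h4 := hM' r r' s J hr.le hJ
  rw [slack_apply]
  linarith

/-- In a nonnegative Monge matrix with zeros in every row and every column, a positive entry with
all zeros of its row to the left leads to a staircase of positive entries in the northeast; at an
inner corner of the staircase both neighbours outside of it are zero. -/
theorem exists_corner {C : Matrix (Fin p) (Fin q) ℝ} (h0 : ∀ i j, 0 ≤ C i j) (hM : IsMonge C)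
    (hrow : ∀ i, ∃ j, C i j = 0) (hcol : ∀ j, ∃ i, C i j = 0)
    (hpos : ∃ r s, 0 < C r s ∧ ∀ t, C r t = 0 → t < s) :
    ∃ (r r' : Fin p) (s' s : Fin q), (r' : ℕ) = r + 1 ∧ (s : ℕ) = s' + 1 ∧
      (∀ i j, i ≤ r → s ≤ j → 0 < C i j) ∧ C r s' = 0 ∧ C r' s = 0 := by
  classical
  have pos : ∀ i j, C i j ≠ 0 → 0 < C i j := fun i j h => lt_of_le_of_ne (h0 i j) h.symm
  obtain ⟨r₀, s₀, hrs₀⟩ := hpos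
  obtain ⟨⟨r, s⟩, hrs, hmax⟩ := Finset.exists_max_image
    (Finset.univ.filter fun x : Fin p × Fin q => 0 < C x.1 x.2 ∧ ∀ t, C x.1 t = 0 → t < x.2)
    (fun x => (x.1 : ℤ) - (x.2 : ℤ)) ⟨(r₀, s₀), by simpa using hrs₀⟩
  simp only [Finset.mem_filter, Finset.mem_univ, true_and] at hrs hmax
  obtain ⟨hC, hz⟩ := hrs
  obtain ⟨t, ht⟩ := hrow r
  have hts := hz t ht
  obtain ⟨u, hu⟩ := hcol s
  have hru : r < u := by
    by_contra hur
    have hne : u ≠ r := by rintro rfl; linarith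
    have := hM u r t s (lt_of_le_of_ne (not_lt.1 hur) hne) hts
    have := h0 u t
    linarith
  have hrp : (r : ℕ) + 1 < p := by have := u.isLt; rw [Fin.lt_def] at hru; omega
  obtain ⟨r', hr'⟩ : ∃ r' : Fin p, (r' : ℕ) = r + 1 := ⟨⟨r + 1, hrp⟩, rfl⟩
  obtain ⟨s', hs'⟩ : ∃ s' : Fin q, (s : ℕ) = s' + 1 := by
    rw [Fin.lt_def] at hts
    exact ⟨⟨s - 1, by omega⟩, by simp; omega⟩
  refine ⟨r, r', s', s, hr', hs', ?_, ?_, ?_⟩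
  · intro i j hi hj
    have hrj : 0 < C r j := pos _ _ fun h => absurd (hz j h) (not_lt.2 hj)
    rcases hi.eq_or_lt with rfl | hi
    · exact hrj
    · refine pos _ _ fun h => ?_
      have := hM i r t j hi (hts.trans_le hj)
      have := h0 i t
      linarith
  · by_contra hne
    have := hmax (r, s') ⟨pos _ _ hne, fun w hw => ?_⟩
    · simp only at this; omega
    · change w < s'
      have h1 := hz w hw
      have h2 : w ≠ s' := by rintro rfl; exact hne hw
      rw [Fin.lt_def] at h1 ⊢
      rw [Ne, Fin.ext_iff] at h2
      omega
  · by_contra hne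
    have := hmax (r', s) ⟨pos _ _ hne, fun w hw => ?_⟩
    · simp only at this; omega
    · by_contra hws
      have h2 : w ≠ s := by rintro rfl; exact hne hw
      have h3 : u ≠ r' := by rintro rfl; exact hne hu
      have := hM r' u s w (by rw [Fin.lt_def] at hru ⊢; rw [Ne, Fin.ext_iff] at h3; omega)
        (lt_of_le_of_ne (not_lt.1 hws) h2.symm)
      have := h0 u w
      have := pos _ _ hne
      linarith

/-- Every nonzero face of the cone of nonnegative Monge matrices contains a block, a row or a
column. -/
theorem exists_tight_vert (C : Matrix (Fin p) (Fin q) ℝ) (hC : ∀ k, 0 ≤ con k C) (hne : C ≠ 0) :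
    ∃ x : Index p q, ∀ k, con k C = 0 → con k (vert x) = 0 := by
  obtain ⟨h0, hM⟩ := (con_nonneg_iff C).1 hC
  -- It suffices to find a vertex whose support and inner corner are those of positive functionals.
  suffices h : ∃ x : Index p q, (∀ (i : Fin p) (j : Fin q), Supp x i j → 0 < C i j) ∧
      ∀ (i I : Fin p) (j J : Fin q), i < I → j < J → Cut x i I j J → 0 < slack i I j J C by
    obtain ⟨x, hS, hK⟩ := h
    refine ⟨x, ?_⟩
    rintro (⟨i, j⟩ | ⟨⟨i, I⟩, ⟨j, J⟩⟩)
    · change C i j = 0 → vert x i j = 0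
      intro hij
      rw [vert_apply, if_neg fun h => (hS i j h).ne' hij]
    · by_cases hij : i < I ∧ j < J
      · simp only [con, hij, and_self, if_true]
        intro hs
        rw [slack_vert x hij.1 hij.2, if_neg fun h => (hK i I j J hij.1 hij.2 h).ne' hs]
      · simp [con, hij]
  have pos : ∀ i j, C i j ≠ 0 → 0 < C i j := fun i j h => lt_of_le_of_ne (h0 i j) h.symm
  by_cases hrow : ∀ i, ∃ j, C i j = 0
  swap
  · push Not at hrow
    obtain ⟨i, hi⟩ := hrow
    refine ⟨.inr (.inr (.inl i)), fun r c h => ?_, by simp [Cut]⟩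
    obtain rfl : r = i := Fin.ext (by simpa [Supp] using h)
    exact pos _ _ (hi c)
  by_cases hcol : ∀ j, ∃ i, C i j = 0
  swap
  · push Not at hcol
    obtain ⟨j, hj⟩ := hcol
    refine ⟨.inr (.inr (.inr j)), fun r c h => ?_, by simp [Cut]⟩
    obtain rfl : c = j := Fin.ext (by simpa [Supp] using h)
    exact pos _ _ (hj r)
  obtain ⟨r, s, hrs⟩ : ∃ r s, C r s ≠ 0 := by
    by_contra! h
    exact hne (by ext i j; exact h i j)
  by_cases hleft : ∀ t, C r t = 0 → t < s
  · obtain ⟨r, r', s', s, hr, hs, hblock, hz, hz'⟩ :=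
      exists_corner h0 hM hrow hcol ⟨r, s, pos _ _ hrs, hleft⟩
    have hr' := r'.isLt
    have hs' := s.isLt
    refine ⟨.inl (⟨r, by omega⟩, ⟨q - 1 - s, by omega⟩), fun i j h => ?_,
      fun i I j J _ _ h => ?_⟩
    · simp only [Supp] at h
      exact hblock i j (Fin.le_def.2 h.1) (Fin.le_def.2 (by omega))
    · simp only [Cut] at h
      refine hM.slack_pos (r := r) (r' := r') (s' := s') (s := s) ?_ ?_ ?_ ?_ ?_ ?_ ?_
      any_goals simp only [Fin.le_def, Fin.lt_def]; omega
      have := hblock r s le_rfl le_rfl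
      have := h0 r' s'
      linarith
  · -- All zeros of the row `r` are to the right of `s`: rotate the matrix by a half-turn.
    have hright : ∀ t, C r t = 0 → s < t := by
      push Not at hleft
      obtain ⟨t, ht, hst⟩ := hleft
      have hst : s < t := lt_of_le_of_ne hst (by rintro rfl; exact hrs ht)
      by_contra! h
      obtain ⟨w, hw, hws⟩ := h
      have hws : w < s := lt_of_le_of_ne hws (by rintro rfl; exact hrs hw)
      obtain ⟨u, hu⟩ := hcol s
      have := pos _ _ hrs
      have hur : u ≠ r := by rintro rfl; exact hrs hu
      rcases lt_or_gt_of_ne hur with h | h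
      · have := hM u r w s h hws
        have := h0 u w
        linarith
      · have := hM r u s t h hst
        have := h0 u t
        linarith
    obtain ⟨r, r', s', s, hr, hs, hblock, hz, hz'⟩ :=
      exists_corner (C := fun i j => C i.rev j.rev) (fun i j => h0 _ _)
        (fun i I j J hi hj => by
          have := hM I.rev i.rev J.rev j.rev (Fin.rev_lt_rev.2 hi) (Fin.rev_lt_rev.2 hj)
          linarith)
        (fun i => by obtain ⟨j, hj⟩ := hrow i.rev; exact ⟨j.rev, by simpa using hj⟩)
        (fun j => by obtain ⟨i, hi⟩ := hcol j.rev; exact ⟨i.rev, by simpa using hi⟩)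
        ⟨r.rev, s.rev, by simpa using pos _ _ hrs, fun t ht => by
          have := hright t.rev (by simpa using ht)
          rwa [← Fin.rev_lt_rev, Fin.rev_rev]⟩
    have hr' := r'.isLt
    have hs' := s.isLt
    refine ⟨.inr (.inl (⟨r, by omega⟩, ⟨q - 1 - s, by omega⟩)), fun i j h => ?_,
      fun i I j J _ _ h => ?_⟩
    · simp only [Supp] at h
      have := hblock i.rev j.rev (by simp only [Fin.le_def, Fin.val_rev]; omega)
        (by simp only [Fin.le_def, Fin.val_rev]; omega)
      simpa using this
    · simp only [Cut] at h
      refine hM.slack_pos (r := r'.rev) (r' := r.rev) (s' := s.rev) (s := s'.rev)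
        ?_ ?_ ?_ ?_ ?_ ?_ ?_
      any_goals simp only [Fin.le_def, Fin.lt_def, Fin.val_rev]; omega
      have := hblock r s le_rfl le_rfl
      have := h0 r'.rev s'.rev
      linarith

end Monge

/-! ### Adjacency of the vertices -/

set_option linter.unusedSimpArgs false

namespace Monge

variable {p q : ℕ}

/-- The ordered pairs of different vertices, each in one of its two orders, that do not span
an edge. -/
def Bad : Index p q → Index p q → Prop
  | .inl (a, b), .inr (.inl (a', b')) =>
      p ≤ a + a' + 2 ∧ q ≤ b + b' + 2 ∧ ¬ (a + a' + 2 = p ∧ b + b' + 2 = q)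
  | .inr (.inr (.inl i)), .inl (a, _) => i + 1 = p ∧ a + 2 = p
  | .inr (.inr (.inl i)), .inr (.inl (a, _)) => (i : ℕ) = 0 ∧ a + 2 = p
  | .inr (.inr (.inr j)), .inl (_, b) => (j : ℕ) = 0 ∧ b + 2 = q
  | .inr (.inr (.inr j)), .inr (.inl (_, b)) => j + 1 = q ∧ b + 2 = q
  | .inr (.inr (.inl i)), .inr (.inr (.inl i')) => p = 2 ∧ i < i'
  | .inr (.inr (.inr j)), .inr (.inr (.inr j')) => q = 2 ∧ j < j'
  | _, _ => False

theorem supp_of_dom {z x y : Index p q} (h : ConeSlice.Dom con vert z x y) (r c : ℕ) (hr : r < p)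
    (hc : c < q) (hz : Supp z r c) : Supp x r c ∨ Supp y r c :=
  ((dom_iff z x y).1 h).1 ⟨r, hr⟩ ⟨c, hc⟩ hz

theorem cut_of_dom {z x y : Index p q} (h : ConeSlice.Dom con vert z x y) (r c : ℕ)
    (hr : r + 1 < p) (hc : c + 1 < q) (hz : Cut z r (r + 1) c (c + 1)) :
    Cut x r (r + 1) c (c + 1) ∨ Cut y r (r + 1) c (c + 1) :=
  ((dom_iff z x y).1 h).2 ⟨r, by omega⟩ ⟨r + 1, hr⟩ ⟨c, by omega⟩ ⟨c + 1, hc⟩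
    (by simp [Fin.lt_def]) (by simp [Fin.lt_def]) hz

theorem eq_of_dom_self (hp : 2 ≤ p) (hq : 2 ≤ q) {x z : Index p q}
    (h : ConeSlice.Dom con vert z x x) : z = x := by
  have hS := supp_of_dom h
  have hC := cut_of_dom h
  rcases z with ⟨⟨c, hc⟩, ⟨d, hd⟩⟩ | ⟨⟨c, hc⟩, ⟨d, hd⟩⟩ | ⟨k, hk⟩ | ⟨k, hk⟩
  · have h1 := hS 0 (q - 1) (by omega) (by omega)
      (by simp only [Supp]; omega)
    have h2 := hC c (q - 2 - d) (by omega) (by omega)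
      (by simp only [Cut]; omega)
    rcases x with ⟨⟨a, ha⟩, ⟨b, hb⟩⟩ | ⟨⟨a, ha⟩, ⟨b, hb⟩⟩ | ⟨i, hi⟩ | ⟨j, hj⟩ <;>
    simp only [Supp, Cut, Sum.inl.injEq, Sum.inr.injEq, Prod.mk.injEq, Fin.mk.injEq, Fin.mk_lt_mk, reduceCtorEq,
      or_self, and_self, imp_false] at h1 h2 ⊢ <;> omega
  · have h1 := hS (p - 1) 0 (by omega) (by omega)
      (by simp only [Supp]; omega)
    have h2 := hC (p - 2 - c) d (by omega) (by omega)
      (by simp only [Cut]; omega)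
    rcases x with ⟨⟨a, ha⟩, ⟨b, hb⟩⟩ | ⟨⟨a, ha⟩, ⟨b, hb⟩⟩ | ⟨i, hi⟩ | ⟨j, hj⟩ <;>
    simp only [Supp, Cut, Sum.inl.injEq, Sum.inr.injEq, Prod.mk.injEq, Fin.mk.injEq, Fin.mk_lt_mk, reduceCtorEq,
      or_self, and_self, imp_false] at h1 h2 ⊢ <;> omega
  · have h1 := hS k 0 hk (by omega) rfl
    have h2 := hS k (q - 1) hk (by omega) rfl
    rcases x with ⟨⟨a, ha⟩, ⟨b, hb⟩⟩ | ⟨⟨a, ha⟩, ⟨b, hb⟩⟩ | ⟨i, hi⟩ | ⟨j, hj⟩ <;>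
    simp only [Supp, Sum.inl.injEq, Sum.inr.injEq, Prod.mk.injEq, Fin.mk.injEq, Fin.mk_lt_mk, reduceCtorEq,
      or_self] at h1 h2 ⊢ <;> omega
  · have h1 := hS 0 k (by omega) hk rfl
    have h2 := hS (p - 1) k (by omega) hk rfl
    rcases x with ⟨⟨a, ha⟩, ⟨b, hb⟩⟩ | ⟨⟨a, ha⟩, ⟨b, hb⟩⟩ | ⟨i, hi⟩ | ⟨j, hj⟩ <;>
    simp only [Supp, Sum.inl.injEq, Sum.inr.injEq, Prod.mk.injEq, Fin.mk.injEq, Fin.mk_lt_mk, reduceCtorEq,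
      or_self] at h1 h2 ⊢ <;> omega

theorem isRaySystem (hp : 2 ≤ p) (hq : 2 ≤ q) :
    ConeSlice.IsRaySystem con total (vert (p := p) (q := q)) where
  nonneg := con_vert_nonneg
  sum_eq_one := total_vert (by omega) (by omega)
  pointed := con_pointed
  exists_tight := exists_tight_vert
  extremal _ _ := eq_of_dom_self hp hq

/-- A row lies in the union of the supports of two other vertices only for the pairs in `Bad`. -/
theorem eq_or_eq_of_dom_row (hq : 2 ≤ q) {x y : Index p q} (hxy : x ≠ y)
    (h1 : ¬ Bad x y) (h2 : ¬ Bad y x) (k : Fin p)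
    (h : ConeSlice.Dom con vert (.inr (.inr (.inl k))) x y) :
    .inr (.inr (.inl k)) = x ∨ .inr (.inr (.inl k)) = y := by
  have hS := supp_of_dom h
  obtain ⟨k, hk⟩ := k
  have s1 := hS k 0 hk (by omega) rfl
  have s2 := hS k 1 hk (by omega) rfl
  have s3 := hS k (q - 2) hk (by omega) rfl
  have s4 := hS k (q - 1) hk (by omega) rfl
  have s5 := fun (b : ℕ) (hb : b + 1 < q) => hS k (b + 1) hk hb rfl
  rcases x with ⟨⟨a, ha⟩, ⟨b, hb⟩⟩ | ⟨⟨a, ha⟩, ⟨b, hb⟩⟩ | ⟨i, hi⟩ | ⟨j, hj⟩ <;>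
  rcases y with ⟨⟨a', ha'⟩, ⟨b', hb'⟩⟩ | ⟨⟨a', ha'⟩, ⟨b', hb'⟩⟩ | ⟨i', hi'⟩ | ⟨j', hj'⟩ <;>
  simp only [Supp, Bad, Sum.inl.injEq, Sum.inr.injEq, Prod.mk.injEq, Fin.mk.injEq, Fin.mk_lt_mk, reduceCtorEq,
    not_false_eq_true, ne_eq, or_self, or_false, false_or] at hxy h1 h2 s1 s2 s3 s4 s5 ⊢ <;>
  first
  | omega
  | (have t1 := s5 b (by omega); omega)
  | (have t1 := s5 b' (by omega); omega)

theorem eq_or_eq_of_dom_col (hp : 2 ≤ p) (hq : 2 ≤ q) {x y : Index p q} (hxy : x ≠ y)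
    (h1 : ¬ Bad x y) (h2 : ¬ Bad y x) (k : Fin q)
    (h : ConeSlice.Dom con vert (.inr (.inr (.inr k))) x y) :
    .inr (.inr (.inr k)) = x ∨ .inr (.inr (.inr k)) = y := by
  have hS := supp_of_dom h
  obtain ⟨k, hk⟩ := k
  have s1 := hS 0 k (by omega) hk rfl
  have s2 := hS 1 k (by omega) hk rfl
  have s3 := hS (p - 2) k (by omega) hk rfl
  have s4 := hS (p - 1) k (by omega) hk rfl
  have s5 := fun (b : ℕ) (hb : b + 1 < p) => hS (b + 1) k hb hk rfl
  rcases x with ⟨⟨a, ha⟩, ⟨b, hb⟩⟩ | ⟨⟨a, ha⟩, ⟨b, hb⟩⟩ | ⟨i, hi⟩ | ⟨j, hj⟩ <;>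
  rcases y with ⟨⟨a', ha'⟩, ⟨b', hb'⟩⟩ | ⟨⟨a', ha'⟩, ⟨b', hb'⟩⟩ | ⟨i', hi'⟩ | ⟨j', hj'⟩ <;>
  simp only [Supp, Bad, Sum.inl.injEq, Sum.inr.injEq, Prod.mk.injEq, Fin.mk.injEq, Fin.mk_lt_mk, reduceCtorEq,
    not_false_eq_true, ne_eq, or_self, or_false, false_or] at hxy h1 h2 s1 s2 s3 s4 s5 ⊢ <;>
  first
  | omega
  | (have t1 := s5 a (by omega); omega)
  | (have t1 := s5 a' (by omega); omega)

/-- The inner corner of a northeast block is the inner corner of only one southwest block, and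
the two blocks have no row or column in common. -/
theorem eq_or_eq_of_dom_NE (hp : 2 ≤ p) (hq : 2 ≤ q) {x y : Index p q}
    (h1 : ¬ Bad x y) (h2 : ¬ Bad y x) (k : Fin (p - 1) × Fin (q - 1))
    (h : ConeSlice.Dom con vert (.inl k) x y) : .inl k = x ∨ .inl k = y := by
  have hS := supp_of_dom h
  have hC := cut_of_dom h
  obtain ⟨⟨c, hc⟩, ⟨d, hd⟩⟩ := k
  have s1 := hS 0 (q - 1)
      (by omega) (by omega) (by simp only [Supp]; omega)
  have s2 := hS c (q - 1)
      (by omega) (by omega) (by simp only [Supp]; omega)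
  have s3 := hS 0 (q - 1 - d)
      (by omega) (by omega) (by simp only [Supp]; omega)
  have s4 := hS c (q - 1 - d)
      (by omega) (by omega) (by simp only [Supp]; omega)
  have s5 := hC c (q - 2 - d)
      (by omega) (by omega) (by simp only [Cut]; omega)
  rcases x with ⟨⟨a, ha⟩, ⟨b, hb⟩⟩ | ⟨⟨a, ha⟩, ⟨b, hb⟩⟩ | ⟨i, hi⟩ | ⟨j, hj⟩ <;>
  rcases y with ⟨⟨a', ha'⟩, ⟨b', hb'⟩⟩ | ⟨⟨a', ha'⟩, ⟨b', hb'⟩⟩ | ⟨i', hi'⟩ | ⟨j', hj'⟩ <;>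
  simp only [Supp, Cut, Bad, Sum.inl.injEq, Sum.inr.injEq, Prod.mk.injEq, Fin.mk.injEq, Fin.mk_lt_mk,
    reduceCtorEq, not_false_eq_true, or_self, or_false, false_or] at h1 h2 s1 s2 s3 s4 s5 ⊢ <;>
  omega

theorem eq_or_eq_of_dom_SW (hp : 2 ≤ p) (hq : 2 ≤ q) {x y : Index p q}
    (h1 : ¬ Bad x y) (h2 : ¬ Bad y x) (k : Fin (p - 1) × Fin (q - 1))
    (h : ConeSlice.Dom con vert (.inr (.inl k)) x y) :
    .inr (.inl k) = x ∨ .inr (.inl k) = y := by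
  have hS := supp_of_dom h
  have hC := cut_of_dom h
  obtain ⟨⟨c, hc⟩, ⟨d, hd⟩⟩ := k
  have s1 := hS (p - 1) 0
      (by omega) (by omega) (by simp only [Supp]; omega)
  have s2 := hS (p - 1 - c) 0
      (by omega) (by omega) (by simp only [Supp]; omega)
  have s3 := hS (p - 1) d
      (by omega) (by omega) (by simp only [Supp]; omega)
  have s4 := hS (p - 1 - c) d
      (by omega) (by omega) (by simp only [Supp]; omega)
  have s5 := hC (p - 2 - c) d
      (by omega) (by omega) (by simp only [Cut]; omega)
  rcases x with ⟨⟨a, ha⟩, ⟨b, hb⟩⟩ | ⟨⟨a, ha⟩, ⟨b, hb⟩⟩ | ⟨i, hi⟩ | ⟨j, hj⟩ <;>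
  rcases y with ⟨⟨a', ha'⟩, ⟨b', hb'⟩⟩ | ⟨⟨a', ha'⟩, ⟨b', hb'⟩⟩ | ⟨i', hi'⟩ | ⟨j', hj'⟩ <;>
  simp only [Supp, Cut, Bad, Sum.inl.injEq, Sum.inr.injEq, Prod.mk.injEq, Fin.mk.injEq, Fin.mk_lt_mk,
    reduceCtorEq, not_false_eq_true, or_self, or_false, false_or] at h1 h2 s1 s2 s3 s4 s5 ⊢ <;>
  omega

/-- For a pair in `Bad`, some row or column lies in the union of the two supports. -/
theorem exists_dom_of_bad (hp : 2 ≤ p) (hq : 2 ≤ q) {x y : Index p q} (h : Bad x y)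
    (hxy : x ≠ y) : ∃ z, ConeSlice.Dom con vert z x y ∧ z ≠ x ∧ z ≠ y := by
  have row : ∀ k : Fin p, (∀ c : Fin q, Supp x k c ∨ Supp y k c) →
      ConeSlice.Dom con vert (.inr (.inr (.inl k))) x y := by
    intro k hk
    refine (dom_iff _ _ _).2 ⟨fun r c hz => ?_, fun i I j J _ _ hz => by simp [Cut] at hz⟩
    simp only [Supp] at hz
    rw [hz]
    exact hk c
  have col : ∀ k : Fin q, (∀ r : Fin p, Supp x r k ∨ Supp y r k) →
      ConeSlice.Dom con vert (.inr (.inr (.inr k))) x y := by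
    intro k hk
    refine (dom_iff _ _ _).2 ⟨fun r c hz => ?_, fun i I j J _ _ hz => by simp [Cut] at hz⟩
    simp only [Supp] at hz
    rw [hz]
    exact hk r
  rcases x with ⟨⟨a, ha⟩, ⟨b, hb⟩⟩ | ⟨⟨a, ha⟩, ⟨b, hb⟩⟩ | ⟨i, hi⟩ | ⟨j, hj⟩ <;>
  rcases y with ⟨⟨a', ha'⟩, ⟨b', hb'⟩⟩ | ⟨⟨a', ha'⟩, ⟨b', hb'⟩⟩ | ⟨i', hi'⟩ | ⟨j', hj'⟩ <;>
  simp only [Bad, ne_eq, Fin.mk_lt_mk] at h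
  · -- The last row of the northeast block, or the last column of the southwest block.
    by_cases hrow : p < a + a' + 2
    · exact ⟨_, row ⟨a, by omega⟩ (fun c => by simp only [Supp]; omega), by simp, by simp⟩
    · exact ⟨_, col ⟨b', by omega⟩ (fun r => by simp only [Supp]; omega), by simp, by simp⟩
  · exact ⟨_, col ⟨q - 1, by omega⟩ (fun r => by simp only [Supp]; omega), by simp, by simp⟩
  · exact ⟨_, col ⟨0, by omega⟩ (fun r => by simp only [Supp]; omega), by simp, by simp⟩
  · exact ⟨_, col ⟨0, by omega⟩ (fun r => by simp only [Supp]; omega), by simp, by simp⟩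
  · exact ⟨_, row ⟨0, by omega⟩ (fun r => by simp only [Supp]; omega), by simp, by simp⟩
  · exact ⟨_, row ⟨p - 1, by omega⟩ (fun r => by simp only [Supp]; omega), by simp, by simp⟩
  · exact ⟨_, row ⟨0, by omega⟩ (fun r => by simp only [Supp]; omega), by simp, by simp⟩

theorem isAdj_iff (hp : 2 ≤ p) (hq : 2 ≤ q) (x y : Index p q) :
    ConeSlice.IsAdj con vert x y ↔ x ≠ y ∧ ¬ Bad x y ∧ ¬ Bad y x := by
  constructor
  · rintro ⟨hxy, h⟩
    refine ⟨hxy, fun hb => ?_, fun hb => ?_⟩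
    · obtain ⟨z, hz, h1, h2⟩ := exists_dom_of_bad hp hq hb hxy
      exact (h z hz).elim h1 h2
    · obtain ⟨z, hz, h1, h2⟩ := exists_dom_of_bad hp hq hb hxy.symm
      exact (h z fun k hx hy => hz k hy hx).elim h2 h1
  · rintro ⟨hxy, h1, h2⟩
    refine ⟨hxy, fun z hz => ?_⟩
    rcases z with k | k | k | k
    · exact eq_or_eq_of_dom_NE hp hq h1 h2 k hz
    · exact eq_or_eq_of_dom_SW hp hq h1 h2 k hz
    · exact eq_or_eq_of_dom_row hq hxy h1 h2 k hz
    · exact eq_or_eq_of_dom_col hp hq hxy h1 h2 k hz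

end Monge

/-! ### The list of edges -/

namespace Monge

variable {p q : ℕ}

theorem mem_edges_iff (hp : 2 ≤ p) (hq : 2 ≤ q) (F : Set (Matrix (Fin p) (Fin q) ℝ)) :
    F ∈ edges p q ↔
      ∃ x y : Index p q, (x ≠ y ∧ ¬ Bad x y ∧ ¬ Bad y x) ∧ F = convexHull ℝ {vert x, vert y} := by
  simp only [edges, Set.mem_ofPred_eq, polytope_eq_slice, (isRaySystem hp hq).isEdge_iff,
    isAdj_iff hp hq]

theorem exists_fin_of_isBlock {a b : ℕ} (h : IsBlock p q a b) :
    ∃ (a' : Fin (p - 1)) (b' : Fin (q - 1)), a = a' + 1 ∧ b = b' + 1 := by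
  obtain ⟨⟨h1, h2⟩, h3, h4⟩ := h
  exact ⟨⟨a - 1, by omega⟩, ⟨b - 1, by omega⟩, by simp; omega, by simp; omega⟩

theorem exists_fin_succ {n i : ℕ} (h : 1 ≤ i ∧ i ≤ n) : ∃ i' : Fin n, i = i' + 1 :=
  ⟨⟨i - 1, by omega⟩, by simp; omega⟩

theorem isBlock_succ (a : Fin (p - 1)) (b : Fin (q - 1)) : IsBlock p q (a + 1) (b + 1) := by
  unfold IsBlock; omega

theorem hatHOR_ne_hatVER (hp : 2 ≤ p) (hq : 2 ≤ q) (i : Fin p) (j : Fin q) :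
    hatHOR p q (i + 1) ≠ hatVER p q (j + 1) := fun h =>
  absurd ((isRaySystem hp hq).injective (a₁ := .inr (.inr (.inl i)))
    (a₂ := .inr (.inr (.inr j))) h) (by simp)

theorem pair_ne_pair_HOR (hp : 2 ≤ p) (hq : 2 ≤ q) (j : Fin q) (w : Matrix (Fin p) (Fin q) ℝ) :
    ({hatVER p q (j + 1), w} : Set _) ≠ {hatHOR p q 1, hatHOR p q 2} := by
  intro h
  have : hatVER p q (j + 1) ∈ ({hatHOR p q 1, hatHOR p q 2} : Set _) := h ▸ Set.mem_insert _ _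
  rcases this with h1 | h1
  · exact hatHOR_ne_hatVER hp hq ⟨0, by omega⟩ j h1.symm
  · exact hatHOR_ne_hatVER hp hq ⟨1, by omega⟩ j h1.symm

theorem pair_ne_pair_VER (hp : 2 ≤ p) (hq : 2 ≤ q) (i : Fin p) (w : Matrix (Fin p) (Fin q) ℝ) :
    ({hatHOR p q (i + 1), w} : Set _) ≠ {hatVER p q 1, hatVER p q 2} := by
  intro h
  have : hatHOR p q (i + 1) ∈ ({hatVER p q 1, hatVER p q 2} : Set _) := h ▸ Set.mem_insert _ _
  rcases this with h1 | h1
  · exact hatHOR_ne_hatVER hp hq i ⟨0, by omega⟩ h1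
  · exact hatHOR_ne_hatVER hp hq i ⟨1, by omega⟩ h1

theorem edges_eq (hp : 2 ≤ p) (hq : 2 ≤ q) : Monge.edges p q =
      {F | ∃ i a b, (1 ≤ i ∧ i ≤ p) ∧ Monge.IsBlock p q a b ∧ ¬ (i = p ∧ a = p - 1) ∧
        F = convexHull ℝ {Monge.hatHOR p q i, Monge.hatNE p q a b}} ∪
      {F | ∃ i a b, (1 ≤ i ∧ i ≤ p) ∧ Monge.IsBlock p q a b ∧ ¬ (i = 1 ∧ a = p - 1) ∧
        F = convexHull ℝ {Monge.hatHOR p q i, Monge.hatSW p q a b}} ∪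
      {F | ∃ j a b, (1 ≤ j ∧ j ≤ q) ∧ Monge.IsBlock p q a b ∧ ¬ (j = 1 ∧ b = q - 1) ∧
        F = convexHull ℝ {Monge.hatVER p q j, Monge.hatNE p q a b}} ∪
      {F | ∃ j a b, (1 ≤ j ∧ j ≤ q) ∧ Monge.IsBlock p q a b ∧ ¬ (j = q ∧ b = q - 1) ∧
        F = convexHull ℝ {Monge.hatVER p q j, Monge.hatSW p q a b}} ∪
      {F | ∃ v ∈ Monge.verticesNE p q, ∃ w ∈ Monge.verticesNE p q, v ≠ w ∧
        F = convexHull ℝ {v, w}} ∪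
      {F | ∃ v ∈ Monge.verticesSW p q, ∃ w ∈ Monge.verticesSW p q, v ≠ w ∧
        F = convexHull ℝ {v, w}} ∪
      {F | ∃ a b a' b', Monge.IsBlock p q a b ∧ Monge.IsBlock p q a' b' ∧
        (a + a' < p ∨ b + b' < q ∨ (a + a' = p ∧ b + b' = q)) ∧
        F = convexHull ℝ {Monge.hatNE p q a b, Monge.hatSW p q a' b'}} ∪
      {F | ∃ v ∈ Monge.verticesStrip p q, ∃ w ∈ Monge.verticesStrip p q, v ≠ w ∧
        ¬ (p = 2 ∧ ({v, w} : Set _) = {Monge.hatHOR p q 1, Monge.hatHOR p q 2}) ∧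
        ¬ (q = 2 ∧ ({v, w} : Set _) = {Monge.hatVER p q 1, Monge.hatVER p q 2}) ∧
        F = convexHull ℝ {v, w}} := by
  have inj := (isRaySystem hp hq).injective
  have range {n : ℕ} (i : Fin n) : 1 ≤ (i : ℕ) + 1 ∧ (i : ℕ) + 1 ≤ n := by omega
  ext F
  simp only [mem_edges_iff hp hq, Set.mem_union, Set.mem_ofPred_eq]
  constructor
  · rintro ⟨x, y, ⟨hxy, h1, h2⟩, rfl⟩
    have hv := inj.ne hxy
    rcases x with ⟨a, b⟩ | ⟨a, b⟩ | i | j <;> rcases y with ⟨a', b'⟩ | ⟨a', b'⟩ | i' | j' <;>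
      simp only [Bad] at h1 h2
    · refine .inl <| .inl <| .inl <| .inr ⟨_, ?_, _, ?_, hv, rfl⟩
      exacts [⟨_, _, isBlock_succ a b, rfl⟩, ⟨_, _, isBlock_succ a' b', rfl⟩]
    · exact .inl <| .inr ⟨_, _, _, _, isBlock_succ a b, isBlock_succ a' b', by omega, rfl⟩
    · rw [Set.pair_comm]
      exact .inl <| .inl <| .inl <| .inl <| .inl <| .inl <| .inl
        ⟨_, _, _, range i', isBlock_succ a b, by omega, rfl⟩
    · rw [Set.pair_comm]
      exact .inl <| .inl <| .inl <| .inl <| .inl <| .inr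
        ⟨_, _, _, range j', isBlock_succ a b, by omega, rfl⟩
    · rw [Set.pair_comm]
      exact .inl <| .inr ⟨_, _, _, _, isBlock_succ a' b', isBlock_succ a b, by omega, rfl⟩
    · refine .inl <| .inl <| .inr ⟨_, ?_, _, ?_, hv, rfl⟩
      exacts [⟨_, _, isBlock_succ a b, rfl⟩, ⟨_, _, isBlock_succ a' b', rfl⟩]
    · rw [Set.pair_comm]
      exact .inl <| .inl <| .inl <| .inl <| .inl <| .inl <| .inr
        ⟨_, _, _, range i', isBlock_succ a b, by omega, rfl⟩
    · rw [Set.pair_comm]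
      exact .inl <| .inl <| .inl <| .inl <| .inr
        ⟨_, _, _, range j', isBlock_succ a b, by omega, rfl⟩
    · exact .inl <| .inl <| .inl <| .inl <| .inl <| .inl <| .inl
        ⟨_, _, _, range i, isBlock_succ a' b', by omega, rfl⟩
    · exact .inl <| .inl <| .inl <| .inl <| .inl <| .inl <| .inr
        ⟨_, _, _, range i, isBlock_succ a' b', by omega, rfl⟩
    · refine .inr ⟨_, .inl ⟨_, range i, rfl⟩, _, .inl ⟨_, range i', rfl⟩, hv, ?_, ?_, rfl⟩
      · have : i ≠ i' := by rintro rfl; exact hxy rfl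
        omega
      · exact fun h => pair_ne_pair_VER hp hq i _ h.2
    · refine .inr ⟨_, .inl ⟨_, range i, rfl⟩, _, .inr ⟨_, range j', rfl⟩, hv, ?_, ?_, rfl⟩
      · rw [Set.pair_comm (hatHOR p q (i + 1))]
        exact fun h => pair_ne_pair_HOR hp hq j' _ h.2
      · exact fun h => pair_ne_pair_VER hp hq i _ h.2
    · exact .inl <| .inl <| .inl <| .inl <| .inl <| .inr
        ⟨_, _, _, range j, isBlock_succ a' b', by omega, rfl⟩
    · exact .inl <| .inl <| .inl <| .inl <| .inr
        ⟨_, _, _, range j, isBlock_succ a' b', by omega, rfl⟩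
    · refine .inr ⟨_, .inr ⟨_, range j, rfl⟩, _, .inl ⟨_, range i', rfl⟩, hv, ?_, ?_, rfl⟩
      · exact fun h => pair_ne_pair_HOR hp hq j _ h.2
      · rw [Set.pair_comm (hatVER p q (j + 1))]
        exact fun h => pair_ne_pair_VER hp hq i' _ h.2
    · refine .inr ⟨_, .inr ⟨_, range j, rfl⟩, _, .inr ⟨_, range j', rfl⟩, hv, ?_, ?_, rfl⟩
      · exact fun h => pair_ne_pair_HOR hp hq j _ h.2
      · have : j ≠ j' := by rintro rfl; exact hxy rfl
        omega
  · rintro (((((((⟨i, a, b, hi, hb, hne, rfl⟩ | ⟨i, a, b, hi, hb, hne, rfl⟩) |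
      ⟨j, a, b, hj, hb, hne, rfl⟩) | ⟨j, a, b, hj, hb, hne, rfl⟩) |
      ⟨_, ⟨a, b, hb, rfl⟩, _, ⟨a', b', hb', rfl⟩, hne, rfl⟩) |
      ⟨_, ⟨a, b, hb, rfl⟩, _, ⟨a', b', hb', rfl⟩, hne, rfl⟩) |
      ⟨a, b, a', b', hb, hb', hne, rfl⟩) | ⟨v, hv, w, hw, hne, hne1, hne2, rfl⟩)
    · obtain ⟨i, rfl⟩ := exists_fin_succ hi
      obtain ⟨a, b, rfl, rfl⟩ := exists_fin_of_isBlock hb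
      exact ⟨.inr (.inr (.inl i)), .inl (a, b), ⟨by simp, by simp only [Bad]; omega, by simp [Bad]⟩,
        rfl⟩
    · obtain ⟨i, rfl⟩ := exists_fin_succ hi
      obtain ⟨a, b, rfl, rfl⟩ := exists_fin_of_isBlock hb
      exact ⟨.inr (.inr (.inl i)), .inr (.inl (a, b)),
        ⟨by simp, by simp only [Bad]; omega, by simp [Bad]⟩, rfl⟩
    · obtain ⟨j, rfl⟩ := exists_fin_succ hj
      obtain ⟨a, b, rfl, rfl⟩ := exists_fin_of_isBlock hb
      exact ⟨.inr (.inr (.inr j)), .inl (a, b), ⟨by simp, by simp only [Bad]; omega, by simp [Bad]⟩,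
        rfl⟩
    · obtain ⟨j, rfl⟩ := exists_fin_succ hj
      obtain ⟨a, b, rfl, rfl⟩ := exists_fin_of_isBlock hb
      exact ⟨.inr (.inr (.inr j)), .inr (.inl (a, b)),
        ⟨by simp, by simp only [Bad]; omega, by simp [Bad]⟩, rfl⟩
    · obtain ⟨a, b, rfl, rfl⟩ := exists_fin_of_isBlock hb
      obtain ⟨a', b', rfl, rfl⟩ := exists_fin_of_isBlock hb'
      exact ⟨.inl (a, b), .inl (a', b'), ⟨fun h => hne (congrArg vert h), by simp [Bad],
        by simp [Bad]⟩, rfl⟩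
    · obtain ⟨a, b, rfl, rfl⟩ := exists_fin_of_isBlock hb
      obtain ⟨a', b', rfl, rfl⟩ := exists_fin_of_isBlock hb'
      exact ⟨.inr (.inl (a, b)), .inr (.inl (a', b')), ⟨fun h => hne (congrArg vert h),
        by simp [Bad], by simp [Bad]⟩, rfl⟩
    · obtain ⟨a, b, rfl, rfl⟩ := exists_fin_of_isBlock hb
      obtain ⟨a', b', rfl, rfl⟩ := exists_fin_of_isBlock hb'
      exact ⟨.inl (a, b), .inr (.inl (a', b')), ⟨by simp, by simp only [Bad]; omega,
        by simp [Bad]⟩, rfl⟩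
    · -- For `n = 2` a pair of different indices in `Fin n` is the pair of all indices.
      have pair {n : ℕ} (f : ℕ → Matrix (Fin p) (Fin q) ℝ) (i i' : Fin n) (hn : n = 2)
          (h : i < i') : ({f (i + 1), f (i' + 1)} : Set _) = {f 1, f 2} := by
        rw [Fin.lt_def] at h
        rw [show (i : ℕ) = 0 by omega, show (i' : ℕ) = 1 by omega]
      rcases hv with ⟨i, hi, rfl⟩ | ⟨j, hj, rfl⟩ <;> rcases hw with ⟨i', hi', rfl⟩ | ⟨j', hj', rfl⟩
      · obtain ⟨i, rfl⟩ := exists_fin_succ hi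
        obtain ⟨i', rfl⟩ := exists_fin_succ hi'
        refine ⟨.inr (.inr (.inl i)), .inr (.inr (.inl i')), ⟨fun h => hne (congrArg vert h),
          fun h => hne1 ⟨h.1, pair _ i i' h.1 h.2⟩, fun h => hne1 ⟨h.1, ?_⟩⟩, rfl⟩
        rw [Set.pair_comm]
        exact pair _ i' i h.1 h.2
      · obtain ⟨i, rfl⟩ := exists_fin_succ hi
        obtain ⟨j', rfl⟩ := exists_fin_succ hj'
        exact ⟨.inr (.inr (.inl i)), .inr (.inr (.inr j')), ⟨by simp, by simp [Bad],
          by simp [Bad]⟩, rfl⟩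
      · obtain ⟨j, rfl⟩ := exists_fin_succ hj
        obtain ⟨i', rfl⟩ := exists_fin_succ hi'
        exact ⟨.inr (.inr (.inr j)), .inr (.inr (.inl i')), ⟨by simp, by simp [Bad],
          by simp [Bad]⟩, rfl⟩
      · obtain ⟨j, rfl⟩ := exists_fin_succ hj
        obtain ⟨j', rfl⟩ := exists_fin_succ hj'
        refine ⟨.inr (.inr (.inr j)), .inr (.inr (.inr j')), ⟨fun h => hne (congrArg vert h),
          fun h => hne2 ⟨h.1, pair _ j j' h.1 h.2⟩, fun h => hne2 ⟨h.1, ?_⟩⟩, rfl⟩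
        rw [Set.pair_comm]
        exact pair _ j' j h.1 h.2

end Monge

/-! ### The number of edges -/

namespace Monge

variable {p q : ℕ}

/-- The graph of the Monge polytope. -/
def graph (p q : ℕ) : SimpleGraph (Index p q) where
  Adj x y := x ≠ y ∧ ¬ Bad x y ∧ ¬ Bad y x
  symm := ⟨fun _ _ h => ⟨h.1.symm, h.2.2, h.2.1⟩⟩
  loopless := ⟨fun _ h => h.1 rfl⟩

theorem not_bad_self (x : Index p q) : ¬ Bad x x := by
  rcases x with x | x | x | x <;> simp [Bad]

theorem Bad.asymm {x y : Index p q} (h : Bad x y) : ¬ Bad y x := by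
  intro h'
  rcases x with x | x | x | x <;> rcases y with y | y | y | y <;> simp only [Bad] at h h' <;>
    omega

open Classical in
theorem sum_sum_adj :
    ∑ x : Index p q, ∑ y : Index p q, (if (graph p q).Adj x y then (1 : ℝ) else 0) =
      (Fintype.card (Index p q) : ℝ) ^ 2 - Fintype.card (Index p q) -
        2 * ∑ x : Index p q, ∑ y : Index p q, (if Bad x y then (1 : ℝ) else 0) := by
  have key : ∀ x y : Index p q, (if (graph p q).Adj x y then (1 : ℝ) else 0) =
      1 - (if x = y then 1 else 0) - (if Bad x y then 1 else 0) - (if Bad y x then 1 else 0) := by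
    intro x y
    by_cases hxy : x = y
    · subst hxy
      simp [graph, not_bad_self]
    · by_cases h1 : Bad x y
      · simp [graph, hxy, h1, h1.asymm]
      · by_cases h2 : Bad y x <;> simp [graph, hxy, h1, h2]
  simp only [key, Finset.sum_sub_distrib]
  rw [Finset.sum_comm (f := fun x y : Index p q => if Bad y x then (1 : ℝ) else 0)]
  simp
  ring

theorem sum_ite_succ_eq (n : ℕ) (hn : n ≠ 0) :
    ∑ i : Fin n, (if (i : ℕ) + 1 = n then (1 : ℝ) else 0) = 1 := by
  rw [Finset.sum_eq_single (⟨n - 1, by omega⟩ : Fin n)]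
  · rw [if_pos (by simp; omega)]
  · intro i _ hi
    rw [if_neg]
    intro h
    exact hi (Fin.ext (by simp; omega))
  · simp

theorem sum_ite_eq_zero (n : ℕ) (hn : n ≠ 0) :
    ∑ i : Fin n, (if (i : ℕ) = 0 then (1 : ℝ) else 0) = 1 := by
  rw [Finset.sum_eq_single (⟨0, by omega⟩ : Fin n)]
  · simp
  · intro i _ hi
    rw [if_neg]
    intro h
    exact hi (Fin.ext h)
  · simp

theorem sum_ite_add_two_eq (n : ℕ) (hn : 2 ≤ n) :
    ∑ i : Fin (n - 1), (if (i : ℕ) + 2 = n then (1 : ℝ) else 0) = 1 := by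
  refine (Finset.sum_congr rfl fun i _ => ?_).trans (sum_ite_succ_eq (n - 1) (by omega))
  congr 1
  exact propext (by omega)

/-- The pairs of block heights that together cover all rows. -/
theorem sum_ite_le_add (n : ℕ) (hn : 1 ≤ n) :
    ∑ a : Fin (n - 1), ∑ a' : Fin (n - 1), (if n ≤ (a : ℕ) + a' + 2 then (1 : ℝ) else 0) =
      n * (n - 1) / 2 := by
  obtain ⟨m, rfl⟩ : ∃ m, n = m + 1 := ⟨n - 1, by omega⟩
  have inner : ∀ a : Fin (m + 1 - 1), ∑ a' : Fin (m + 1 - 1),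
      (if m + 1 ≤ (a : ℕ) + a' + 2 then (1 : ℝ) else 0) = (a : ℕ) + 1 := by
    intro a
    have := sum_ite_le_val_add (n := m + 1 - 1) (m := a + 1) (by omega)
    push_cast at this
    rw [← this]
    refine Finset.sum_congr rfl fun r _ => ?_
    congr 1
    exact propext (by omega)
  simp only [inner]
  rw [Fin.sum_univ_eq_sum_range (fun a => (a : ℝ) + 1)]
  simp only [Nat.add_sub_cancel]
  clear inner hn
  induction m with
  | zero => simp
  | succ m ih =>
    rw [Finset.sum_range_succ, ih]
    push_cast
    ring

theorem sum_ite_add_eq (n : ℕ) (hn : 1 ≤ n) :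
    ∑ a : Fin (n - 1), ∑ a' : Fin (n - 1), (if (a : ℕ) + a' + 2 = n then (1 : ℝ) else 0) =
      n - 1 := by
  have inner : ∀ a : Fin (n - 1), ∑ a' : Fin (n - 1),
      (if (a : ℕ) + a' + 2 = n then (1 : ℝ) else 0) = 1 := by
    intro a
    rw [Finset.sum_eq_single a.rev]
    · rw [if_pos (by rw [Fin.val_rev]; omega)]
    · intro i _ hi
      rw [if_neg]
      intro h
      exact hi (Fin.ext (by rw [Fin.val_rev]; omega))
    · simp
  simp only [inner]
  simp [Nat.cast_sub hn]

theorem sum_ite_two_lt (n : ℕ) :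
    ∑ i : Fin n, ∑ i' : Fin n, (if n = 2 ∧ i < i' then (1 : ℝ) else 0) =
      if n = 2 then 1 else 0 := by
  by_cases hn : n = 2
  · subst hn
    simp only [Fin.sum_univ_two]
    simp
  · simp [hn]

/-- The product form of a double sum of indicators. -/
theorem sum_sum_ite_and {ι κ : Type*} [Fintype ι] [Fintype κ] (P : ι → Prop) (Q : κ → Prop)
    [DecidablePred P] [DecidablePred Q] :
    ∑ i, ∑ k, (if P i ∧ Q k then (1 : ℝ) else 0) =
      (∑ i, if P i then 1 else 0) * ∑ k, if Q k then 1 else 0 := by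
  rw [Finset.sum_mul_sum]
  refine Finset.sum_congr rfl fun i _ => Finset.sum_congr rfl fun k _ => ?_
  by_cases h1 : P i <;> by_cases h2 : Q k <;> simp [h1, h2]

theorem sum_bad_NE_SW (hp : 2 ≤ p) (hq : 2 ≤ q) :
    ∑ x : Fin (p - 1) × Fin (q - 1), ∑ y : Fin (p - 1) × Fin (q - 1),
      (if p ≤ (x.1 : ℕ) + y.1 + 2 ∧ q ≤ (x.2 : ℕ) + y.2 + 2 ∧
        ¬ ((x.1 : ℕ) + y.1 + 2 = p ∧ (x.2 : ℕ) + y.2 + 2 = q) then (1 : ℝ) else 0) =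
      p * (p - 1) / 2 * (q * (q - 1) / 2) - (p - 1) * (q - 1) := by
  have key : ∀ x y : Fin (p - 1) × Fin (q - 1),
      (if p ≤ (x.1 : ℕ) + y.1 + 2 ∧ q ≤ (x.2 : ℕ) + y.2 + 2 ∧
        ¬ ((x.1 : ℕ) + y.1 + 2 = p ∧ (x.2 : ℕ) + y.2 + 2 = q) then (1 : ℝ) else 0) =
      (if p ≤ (x.1 : ℕ) + y.1 + 2 then 1 else 0) * (if q ≤ (x.2 : ℕ) + y.2 + 2 then 1 else 0) -
      (if (x.1 : ℕ) + y.1 + 2 = p then 1 else 0) *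
        (if (x.2 : ℕ) + y.2 + 2 = q then 1 else 0) := by
    intro x y
    grind
  have prod : ∀ (f : Fin (p - 1) → Fin (p - 1) → ℝ) (g : Fin (q - 1) → Fin (q - 1) → ℝ),
      ∑ x : Fin (p - 1) × Fin (q - 1), ∑ y : Fin (p - 1) × Fin (q - 1),
        f x.1 y.1 * g x.2 y.2 = (∑ a, ∑ a', f a a') * ∑ b, ∑ b', g b b' := by
    intro f g
    simp only [Fintype.sum_prod_type, ← Finset.sum_mul_sum]
  simp only [key, Finset.sum_sub_distrib]
  rw [prod (fun a a' => if p ≤ (a : ℕ) + a' + 2 then 1 else 0)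
      (fun b b' => if q ≤ (b : ℕ) + b' + 2 then 1 else 0),
    prod (fun a a' => if (a : ℕ) + a' + 2 = p then 1 else 0)
      (fun b b' => if (b : ℕ) + b' + 2 = q then 1 else 0),
    sum_ite_le_add p (by omega), sum_ite_le_add q (by omega), sum_ite_add_eq p (by omega),
    sum_ite_add_eq q (by omega)]

/-- The indicator of `Bad`, with the conditions spelled out so that they carry the decidability
instances needed for the evaluation of sums. -/
def badIndicator : Index p q → Index p q → ℝ
  | .inl (a, b), .inr (.inl (a', b')) =>
      if p ≤ (a : ℕ) + a' + 2 ∧ q ≤ (b : ℕ) + b' + 2 ∧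
        ¬ ((a : ℕ) + a' + 2 = p ∧ (b : ℕ) + b' + 2 = q) then 1 else 0
  | .inr (.inr (.inl i)), .inl x => if (i : ℕ) + 1 = p ∧ (x.1 : ℕ) + 2 = p then 1 else 0
  | .inr (.inr (.inl i)), .inr (.inl x) => if (i : ℕ) = 0 ∧ (x.1 : ℕ) + 2 = p then 1 else 0
  | .inr (.inr (.inr j)), .inl x => if (j : ℕ) = 0 ∧ (x.2 : ℕ) + 2 = q then 1 else 0
  | .inr (.inr (.inr j)), .inr (.inl x) => if (j : ℕ) + 1 = q ∧ (x.2 : ℕ) + 2 = q then 1 else 0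
  | .inr (.inr (.inl i)), .inr (.inr (.inl i')) => if p = 2 ∧ i < i' then 1 else 0
  | .inr (.inr (.inr j)), .inr (.inr (.inr j')) => if q = 2 ∧ j < j' then 1 else 0
  | _, _ => 0

open Classical in
theorem ite_bad (x y : Index p q) : (if Bad x y then (1 : ℝ) else 0) = badIndicator x y := by
  rcases x with x | x | x | x <;> rcases y with y | y | y | y <;>
    first
    | exact if_congr Iff.rfl rfl rfl
    | exact if_neg not_false

open Classical in
theorem sum_sum_bad (hp : 2 ≤ p) (hq : 2 ≤ q) :
    ∑ x : Index p q, ∑ y : Index p q, (if Bad x y then (1 : ℝ) else 0) =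
      p * (p - 1) / 2 * (q * (q - 1) / 2) - (p - 1) * (q - 1) + 2 * (p - 1) + 2 * (q - 1) +
        (if p = 2 then 1 else 0) + (if q = 2 then 1 else 0) := by
  have hp1 : ((p - 1 : ℕ) : ℝ) = p - 1 := by rw [Nat.cast_sub (by omega)]; simp
  have hq1 : ((q - 1 : ℕ) : ℝ) = q - 1 := by rw [Nat.cast_sub (by omega)]; simp
  have first : ∑ x : Fin (p - 1) × Fin (q - 1), (if (x.1 : ℕ) + 2 = p then (1 : ℝ) else 0) =
      q - 1 := by
    rw [Fintype.sum_prod_type_right]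
    simp only [sum_ite_add_two_eq p hp]
    simp [hq1]
  have second : ∑ x : Fin (p - 1) × Fin (q - 1), (if (x.2 : ℕ) + 2 = q then (1 : ℝ) else 0) =
      p - 1 := by
    rw [Fintype.sum_prod_type]
    simp only [sum_ite_add_two_eq q hq]
    simp [hp1]
  simp only [ite_bad, Fintype.sum_sum_type, badIndicator, Finset.sum_const_zero, add_zero, zero_add,
    Finset.sum_add_distrib]
  rw [sum_bad_NE_SW hp hq]
  simp only [sum_sum_ite_and (fun i : Fin p => (i : ℕ) + 1 = p)
      (fun x : Fin (p - 1) × Fin (q - 1) => (x.1 : ℕ) + 2 = p),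
    sum_sum_ite_and (fun i : Fin p => (i : ℕ) = 0)
      (fun x : Fin (p - 1) × Fin (q - 1) => (x.1 : ℕ) + 2 = p),
    sum_sum_ite_and (fun i : Fin q => (i : ℕ) + 1 = q)
      (fun x : Fin (p - 1) × Fin (q - 1) => (x.2 : ℕ) + 2 = q),
    sum_sum_ite_and (fun i : Fin q => (i : ℕ) = 0)
      (fun x : Fin (p - 1) × Fin (q - 1) => (x.2 : ℕ) + 2 = q),
    first, second, sum_ite_succ_eq p (by omega), sum_ite_succ_eq q (by omega),
    sum_ite_eq_zero p (by omega), sum_ite_eq_zero q (by omega), sum_ite_two_lt]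
  ring

theorem ncard_edges (hp : 2 ≤ p) (hq : 2 ≤ q) : ((Monge.edges p q).ncard : ℝ) =
      1 / 4 * (24 - 18 * ((p : ℝ) + q) + 19 * p * q + 2 * ((p : ℝ) ^ 2 + (q : ℝ) ^ 2)
        - 7 * ((p : ℝ) ^ 2 * q + p * (q : ℝ) ^ 2 - (p : ℝ) ^ 2 * (q : ℝ) ^ 2))
      - (if p = 2 then 1 else 0) - (if q = 2 then 1 else 0) := by
  classical
  have h1 : (edges p q).ncard = (graph p q).edgeFinset.card := by
    rw [edges, polytope_eq_slice]
    exact (isRaySystem hp hq).ncard_edges (graph p q) fun x y => (isAdj_iff hp hq x y).symm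
  have h2 : ∑ x : Index p q, ∑ y : Index p q, (if (graph p q).Adj x y then (1 : ℝ) else 0) =
      2 * (graph p q).edgeFinset.card := by
    have := (graph p q).sum_degrees_eq_twice_card_edges
    rw [← Nat.cast_ofNat (R := ℝ), ← Nat.cast_mul, ← this, Nat.cast_sum]
    refine Finset.sum_congr rfl fun x _ => ?_
    rw [← SimpleGraph.card_neighborFinset_eq_degree, SimpleGraph.neighborFinset_eq_filter,
      Finset.sum_boole]
  have h3 : (Fintype.card (Index p q) : ℝ) = 2 * (p - 1) * (q - 1) + p + q := by
    simp only [Fintype.card_sum, Fintype.card_prod, Fintype.card_fin]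
    push_cast [Nat.cast_sub (show 1 ≤ p by omega), Nat.cast_sub (show 1 ≤ q by omega)]
    ring
  rw [sum_sum_adj, sum_sum_bad hp hq, h3] at h2
  rw [h1]
  linarith

end Monge

theorem theorem5p4 (p q : ℕ) (hp : 2 ≤ p) (hq : 2 ≤ q) :
    Monge.edges p q =
      {F | ∃ i a b, (1 ≤ i ∧ i ≤ p) ∧ Monge.IsBlock p q a b ∧ ¬ (i = p ∧ a = p - 1) ∧
        F = convexHull ℝ {Monge.hatHOR p q i, Monge.hatNE p q a b}} ∪
      {F | ∃ i a b, (1 ≤ i ∧ i ≤ p) ∧ Monge.IsBlock p q a b ∧ ¬ (i = 1 ∧ a = p - 1) ∧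
        F = convexHull ℝ {Monge.hatHOR p q i, Monge.hatSW p q a b}} ∪
      {F | ∃ j a b, (1 ≤ j ∧ j ≤ q) ∧ Monge.IsBlock p q a b ∧ ¬ (j = 1 ∧ b = q - 1) ∧
        F = convexHull ℝ {Monge.hatVER p q j, Monge.hatNE p q a b}} ∪
      {F | ∃ j a b, (1 ≤ j ∧ j ≤ q) ∧ Monge.IsBlock p q a b ∧ ¬ (j = q ∧ b = q - 1) ∧
        F = convexHull ℝ {Monge.hatVER p q j, Monge.hatSW p q a b}} ∪
      {F | ∃ v ∈ Monge.verticesNE p q, ∃ w ∈ Monge.verticesNE p q, v ≠ w ∧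
        F = convexHull ℝ {v, w}} ∪
      {F | ∃ v ∈ Monge.verticesSW p q, ∃ w ∈ Monge.verticesSW p q, v ≠ w ∧
        F = convexHull ℝ {v, w}} ∪
      {F | ∃ a b a' b', Monge.IsBlock p q a b ∧ Monge.IsBlock p q a' b' ∧
        (a + a' < p ∨ b + b' < q ∨ (a + a' = p ∧ b + b' = q)) ∧
        F = convexHull ℝ {Monge.hatNE p q a b, Monge.hatSW p q a' b'}} ∪
      {F | ∃ v ∈ Monge.verticesStrip p q, ∃ w ∈ Monge.verticesStrip p q, v ≠ w ∧
        ¬ (p = 2 ∧ ({v, w} : Set _) = {Monge.hatHOR p q 1, Monge.hatHOR p q 2}) ∧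
        ¬ (q = 2 ∧ ({v, w} : Set _) = {Monge.hatVER p q 1, Monge.hatVER p q 2}) ∧
        F = convexHull ℝ {v, w}} ∧
    ((Monge.edges p q).ncard : ℝ) =
      1 / 4 * (24 - 18 * ((p : ℝ) + q) + 19 * p * q + 2 * ((p : ℝ) ^ 2 + (q : ℝ) ^ 2)
        - 7 * ((p : ℝ) ^ 2 * q + p * (q : ℝ) ^ 2 - (p : ℝ) ^ 2 * (q : ℝ) ^ 2))
      - (if p = 2 then 1 else 0) - (if q = 2 then 1 else 0) := by
  exact ⟨Monge.edges_eq hp hq, Monge.ncard_edges hp hq⟩
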